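/- Let $K$ be a local field (nondiscrete, locally compact, totally disconnected) of characteristic $p>0$, with ring of integers $\mathfrak D$, maximal ideal $\mathfrak P$, residue field $\mathfrak D/\mathfrak P$ of cardinality $q=p^c$, and a fixed prime element $\mathfrak p$ (a generator of $\mathfrak P$). Let $dx$ be the Haar measure of $K^+$ normalized by $|\mathfrak D|=1$, and $\langle f,g\rangle=\int_K f\,\overline g\,dx$ on $L^2(K)$. Fix $1=\epsilon_0,\epsilon_1,\dots,\epsilon_{c-1}\in\mathfrak D$ whose classes form a basis of $\mathfrak D/\mathfrak P$ over the field with $p$ elements. For $0\le n<q$, $n=\sum_{i=0}^{c-1}a_ip^i$ with $0\le a_i<p$, put $u(n)=\bigl(\sum_{i=0}^{c-1}a_i\epsilon_i\bigr)\mathfrak p^{-1}$; for general $n=\sum_{i=0}^s b_iq^i$ with $0\le b_i<q$, put $u(n)=\sum_{i=0}^s u(b_i)\mathfrak p^{-i}$. For $y\in K$, $j\in\mathbb Z$, $k\in\mathbb N_0=\{0,1,2,\dots\}$ and $f\in L^2(K)$ let $$\tau_yf(x)=f(x-y),\qquad \delta_jf(x)=q^{j/2}f(\mathfrak p^{-j}x),\qquad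 f_{j,k}=\delta_j\tau_{u(k)}f,$$ $$\tilde f_{j,k}=f_{j,k}\ \text{ if } j\ge 0,\qquad \tilde f_{j,k}=q^{j/2}\tau_{u(k)}\delta_jf\ \text{ if } j<0.$$ Let $\Psi=\{\psi^1,\dots,\psi^L\}$ and $\Phi=\{\varphi^1,\dots,\varphi^L\}$ be finite families in $L^2(K)$ that generate affine Bessel families, that is, there is $B>0$ with $\sum_{l=1}^L\sum_{j\in\mathbb Z}\sum_{k\in\mathbb N_0}|\langle f,\psi^l_{j,k}\rangle|^2\le B\|f\|_2^2$ for all $f\in L^2(K)$, and likewise for $\Phi$. Then for all $f,g\in L^2(K)$ the series $$K_{\Psi,\Phi}(f,g)=\sum_{l=1}^L\sum_{j\in\mathbb Z}\sum_{k\in\mathbb N_0}\langle f,\psi^l_{j,k}\rangle\langle\varphi^l_{j,k},g\rangle,\qquad \tilde K_{\Psi,\Phi}(f,g)=\sum_{l=1}^L\sum_{j\in\mathbb Z}\sum_{k\in\mathbb N_0}\langle f,\tilde\psi^l_{j,k}\rangle\langle\tilde\varphi^l_{j,k},g\rangle$$ converge absolutely, and $K_{\Psi,\Phi}$ is translation invariant,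 i.e. $K_{\Psi,\Phi}(\tau_yf,\tau_yg)=K_{\Psi,\Phi}(f,g)$ for all $y\in K$ and $f,g\in L^2(K)$, if and only if $K_{\Psi,\Phi}=\tilde K_{\Psi,\Phi}$. -/

import Mathlib

open MeasureTheory ValuativeRel
open scoped ENNReal

/-!
`K` is a nonarchimedean local field (a nondiscrete, totally disconnected, locally compact field)
of characteristic `p > 0`. `𝒪[K]` is its ring of integers `𝔇`, and `𝓀[K]` its residue field
`𝔇 / 𝔓`, a finite field with `q` elements.
-/

namespace LocalFieldFrames

section Haar

variable (K : Type*) [Field K] [ValuativeRel K] [TopologicalSpace K] [IsNonarchimedeanLocalField K]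

/-- The ring of integers, as a compact set with nonempty interior. -/
noncomputable def integerCompacts : TopologicalSpace.PositiveCompacts K where
  carrier := (𝒪[K] : Set K)
  isCompact' := IsNonarchimedeanLocalField.isCompact_closedBall K 1
  interior_nonempty' := by
    have h : (𝒪[K] : Set K) ∈ nhds (0 : K) := by
      refine Filter.mem_of_superset
        ((IsValuativeTopology.hasBasis_nhds_zero' K).mem_of_mem (i := 1) one_ne_zero) ?_
      intro x hx
      exact le_of_lt (show valuation K x < 1 from hx)
    exact ⟨0, mem_interior_iff_mem_nhds.mpr h⟩

variable [MeasurableSpace K] [BorelSpace K]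

/-- The Haar measure `dx` of the additive group of `K`, normalized by `|𝔇| = 1`. -/
noncomputable def haar : Measure K := Measure.addHaarMeasure (integerCompacts K)

instance instIsAddHaarMeasureHaar : (haar K).IsAddHaarMeasure := by
  unfold haar; infer_instance

instance instRegularHaar : (haar K).Regular := by
  unfold haar; infer_instance

lemma haar_integer : haar K (𝒪[K] : Set K) = 1 :=
  Measure.addHaarMeasure_self (K₀ := integerCompacts K)

/-- The complex Hilbert space `L²(K)`. -/
abbrev L2 : Type _ := Lp ℂ 2 (haar K)

end Haar

section Lattice

/-- The choices on which the dilations and the translation set depend: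
a prime element `ϖ` of `K` and elements `ε_0 = 1, ε_1, …, ε_{c-1}` of `𝔇` whose residue classes
form a basis of the residue field over its prime field with `p` elements (that is, these `c`
classes span the additive group of the residue field, which has `p ^ c` elements). -/
structure LatticeData (K : Type*) [Field K] [ValuativeRel K] [TopologicalSpace K]
    [IsNonarchimedeanLocalField K] (p : ℕ) where
  ϖ : 𝒪[K]
  irreducible_ϖ : Irreducible ϖ
  c : ℕ
  ε : Fin c → 𝒪[K]
  ε_zero : ∀ i : Fin c, i.val = 0 → ε i = 1
  card_residue : Nat.card 𝓀[K] = p ^ c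
  span_residue : AddSubgroup.closure (Set.range fun i => IsLocalRing.residue 𝒪[K] (ε i)) = ⊤

namespace LatticeData

variable {K : Type*} [Field K] [ValuativeRel K] [TopologicalSpace K] [IsNonarchimedeanLocalField K]
  {p : ℕ} (S : LatticeData K p)

lemma ϖ_ne_zero : (S.ϖ : K) ≠ 0 := fun h => S.irreducible_ϖ.ne_zero (Subtype.ext h)

/-- The cardinality `q = p ^ c` of the residue field. -/
def q (S : LatticeData K p) : ℕ := p ^ S.c

/-- For a digit `b = a_0 + a_1 p + ⋯ + a_{c-1} p ^ (c-1) < q` (base `p` expansion), the element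
`(a_0 + a_1 ε_1 + ⋯ + a_{c-1} ε_{c-1}) ϖ⁻¹` of `K`. -/
noncomputable def uDigit (b : ℕ) : K :=
  (∑ i : Fin S.c, ((b / p ^ i.val % p : ℕ) : K) * (S.ε i : K)) * (S.ϖ : K)⁻¹

/-- For `n = b_0 + b_1 q + ⋯ + b_s q ^ s` (base `q` expansion), the element
`u(n) = u(b_0) + u(b_1) ϖ⁻¹ + ⋯ + u(b_s) ϖ^{-s}` of `K`. -/
noncomputable def u (n : ℕ) : K :=
  ∑ i ∈ Finset.range (Nat.log S.q n + 1), S.uDigit (n / S.q ^ i % S.q) * (S.ϖ : K) ^ (-(i : ℤ))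

end LatticeData

end Lattice

section Systems

variable {K : Type*} [Field K] [ValuativeRel K] [TopologicalSpace K] [IsNonarchimedeanLocalField K]
  [MeasurableSpace K] [BorelSpace K]

/-- Square integrability is preserved by composition with multiplication by a nonzero element. -/
lemma memLp_comp_mul {a : K} (ha : a ≠ 0) (f : L2 K) :
    MemLp (fun x => f (a * x)) 2 (haar K) := by
  let e : K ≃ₜ+ K :=
    { toFun := fun x => a * x
      invFun := fun x => a⁻¹ * x
      left_inv := fun x => inv_mul_cancel_left₀ ha x
      right_inv := fun x => mul_inv_cancel_left₀ ha x
      map_add' := fun x y => mul_add a x y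
      continuous_toFun := continuous_const_mul a
      continuous_invFun := continuous_const_mul a⁻¹ }
  have : (Measure.map e (haar K)).IsAddHaarMeasure := e.isAddHaarMeasure_map (haar K)
  have : (Measure.map e (haar K)).Regular := Measure.Regular.map e.toHomeomorph
  have h := Measure.isAddLeftInvariant_eq_smul_of_regular (Measure.map e (haar K)) (haar K)
  have hf : MemLp f 2 (Measure.map e (haar K)) := by
    rw [h]
    exact (Lp.memLp f).smul_measure ENNReal.coe_ne_top
  exact hf.comp_of_map e.continuous.measurable.aemeasurable

/-- The translation operator `(τ_y f)(x) = f(x - y)` on `L²(K)`. -/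
noncomputable def translation (y : K) (f : L2 K) : L2 K :=
  Lp.compMeasurePreserving (fun x => x - y) (measurePreserving_sub_right (haar K) y) f

/-- The inner product `⟨f, g⟩ = ∫ f(x) conj(g(x)) dx` of `L²(K)`, linear in the first variable. -/
noncomputable def ip (f g : L2 K) : ℂ := inner ℂ g f

lemma ip_eq_integral (f g : L2 K) :
    ip f g = ∫ x, f x * (starRingEnd ℂ) (g x) ∂(haar K) := by
  simp only [ip, L2.inner_def, RCLike.inner_apply]

namespace LatticeData

variable {p : ℕ} (S : LatticeData K p)

/-- The dilation operator `(δ_j f)(x) = q^{j/2} f(ϖ^{-j} x)` on `L²(K)`. -/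
noncomputable def dilation (j : ℤ) (f : L2 K) : L2 K :=
  (((S.q : ℝ) ^ ((j : ℝ) / 2) : ℝ) : ℂ) •
    (memLp_comp_mul (zpow_ne_zero (-j) S.ϖ_ne_zero) f).toLp

/-- `f_{j,k} = δ_j τ_{u(k)} f`. -/
noncomputable def affine (f : L2 K) (j : ℤ) (k : ℕ) : L2 K :=
  S.dilation j (translation (S.u k) f)

/-- `f̃_{j,k}`, equal to `δ_j τ_{u(k)} f` if `j ≥ 0` and to `q^{j/2} τ_{u(k)} δ_j f` if `j < 0`. -/
noncomputable def quasiAffine (f : L2 K) (j : ℤ) (k : ℕ) : L2 K :=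
  if 0 ≤ j then S.dilation j (translation (S.u k) f)
  else (((S.q : ℝ) ^ ((j : ℝ) / 2) : ℝ) : ℂ) • translation (S.u k) (S.dilation j f)

/-- `Ψ = {ψ^1, …, ψ^L}` generates an affine Bessel family: for some `B > 0`, the sum of
`|⟨f, ψ^l_{j,k}⟩|²` over all `l, j, k` is at most `B ‖f‖²`, for all `f ∈ L²(K)`. -/
def IsAffineBessel {L : ℕ} (Ψ : Fin L → L2 K) : Prop :=
  ∃ B : ℝ, 0 < B ∧ ∀ f : L2 K,
    Summable (fun i : Fin L × ℤ × ℕ => ‖ip f (S.affine (Ψ i.1) i.2.1 i.2.2)‖ ^ 2) ∧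
    ∑' i : Fin L × ℤ × ℕ, ‖ip f (S.affine (Ψ i.1) i.2.1 i.2.2)‖ ^ 2 ≤ B * ‖f‖ ^ 2

/-- The term `⟨f, ψ^l_{j,k}⟩ ⟨φ^l_{j,k}, g⟩`. -/
noncomputable def affineTerm {L : ℕ} (Ψ Φ : Fin L → L2 K) (f g : L2 K)
    (l : Fin L) (j : ℤ) (k : ℕ) : ℂ :=
  ip f (S.affine (Ψ l) j k) * ip (S.affine (Φ l) j k) g

/-- The term `⟨f, ψ̃^l_{j,k}⟩ ⟨φ̃^l_{j,k}, g⟩`. -/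
noncomputable def quasiAffineTerm {L : ℕ} (Ψ Φ : Fin L → L2 K) (f g : L2 K)
    (l : Fin L) (j : ℤ) (k : ℕ) : ℂ :=
  ip f (S.quasiAffine (Ψ l) j k) * ip (S.quasiAffine (Φ l) j k) g

/-- The sesquilinear operator `K_{Ψ,Φ}(f, g) = ∑_l ∑_j ∑_k ⟨f, ψ^l_{j,k}⟩ ⟨φ^l_{j,k}, g⟩`. -/
noncomputable def affineForm {L : ℕ} (Ψ Φ : Fin L → L2 K) (f g : L2 K) : ℂ :=
  ∑ l : Fin L, ∑' j : ℤ, ∑' k : ℕ, S.affineTerm Ψ Φ f g l j k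

/-- The quasi-affine operator `K̃_{Ψ,Φ}(f, g) = ∑_l ∑_j ∑_k ⟨f, ψ̃^l_{j,k}⟩ ⟨φ̃^l_{j,k}, g⟩`. -/
noncomputable def quasiAffineForm {L : ℕ} (Ψ Φ : Fin L → L2 K) (f g : L2 K) : ℂ :=
  ∑ l : Fin L, ∑' j : ℤ, ∑' k : ℕ, S.quasiAffineTerm Ψ Φ f g l j k

end LatticeData

/-- `T(τ_y f, τ_y g) = T(f, g)` for all `y ∈ K` and all `f, g ∈ L²(K)`. -/
def IsTranslationInvariant (T : L2 K → L2 K → ℂ) : Prop :=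
  ∀ (y : K) (f g : L2 K), T (translation y f) (translation y g) = T f g

end Systems

end LocalFieldFrames

set_option linter.unusedSectionVars false

/-! In characteristic `p` the digits of `u n` add without carries. So the points `u n` form a
subgroup of `K` representing `K / 𝔇`, and its first `q ^ N` elements form a subgroup representing
`ϖ^{-N} 𝔇 / 𝔇`. Split both forms into layers, one for each scale `j`. The quasi-affine layer at any
scale `j ≥ -N` is the mean, over `b < q ^ N`, of the affine layers of the translates of `f` and `g`
by `-u b` (`quasiAffineLayer_eq`, with `quasiAffineEnergy_eq` for the squared coefficients). For `j
≥ 0` the affine layer is already invariant under these translations. For `j < 0` the weight `q^j` is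
exactly what averaging produces. In particular quasi-affine families inherit the Bessel bound,
whence absolute convergence.

If `K_{Ψ,Φ}` is translation invariant, it equals the mean of its own values at these translates.
Scales `≥ -N` then cancel in `K_{Ψ,Φ} - K̃_{Ψ,Φ}`, leaving a convergent quasi-affine tail and an
averaged affine tail. The latter is controlled by `tailMean`, and the crux is that it tends to `0`
(`tendsto_tailMean`). For `f` supported on `𝔇`, the translates with `b ≠ 0` live on disjoint cosets
inside `ϖ^{-N} 𝔇 \ 𝔇`. Undoing the dilations turns this set into unions of shells in `𝔇` which
overlap at most `N` times, so the mean is `O(N / q ^ N)`. Translation, finite sums and the uniform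
Bessel bound extend this to all `f`.

Conversely, `K̃_{Ψ,Φ}` is always invariant under the translations by `u t`, and `K_{Ψ,Φ}` under
dilations. If the two agree, `K_{Ψ,Φ}` is invariant under all translations by `ϖ^m u t`. These
points are dense in `K`, and `K_{Ψ,Φ}` is continuous. -/

namespace LocalFieldFrames

namespace LatticeData

/-! ### Arithmetic of the translation set. -/

section Arithmetic

variable {K : Type*} [Field K] [ValuativeRel K] [TopologicalSpace K] [IsNonarchimedeanLocalField K]
  {p : ℕ} (S : LatticeData K p)

/-- The representative `a_0 + a_1 ε_1 + ⋯ + a_{c-1} ε_{c-1}` of a residue class. -/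
noncomputable def digit (b : ℕ) : 𝒪[K] :=
  ∑ i : Fin S.c, ((b / p ^ i.val % p : ℕ) : 𝒪[K]) * S.ε i

lemma uDigit_eq (b : ℕ) : S.uDigit b = (S.digit b : K) * (S.ϖ : K)⁻¹ := by
  simp [uDigit, digit]

@[simp] lemma digit_zero : S.digit 0 = 0 := by simp [digit]

@[simp] lemma uDigit_zero : S.uDigit 0 = 0 := by simp [uDigit_eq]

@[simp] lemma u_zero : S.u 0 = 0 := by simp [u]

variable [hp : Fact p.Prime]

lemma q_pos : 0 < S.q := pow_pos hp.out.pos _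

lemma one_lt_q : 1 < S.q := by
  have h : Nat.card 𝓀[K] = S.q := S.card_residue
  rw [← h]
  exact Finite.one_lt_card

lemma u_eq_sum {n s : ℕ} (h : n < S.q ^ s) :
    S.u n = ∑ i ∈ Finset.range s, S.uDigit (n / S.q ^ i % S.q) * (S.ϖ : K) ^ (-(i : ℤ)) := by
  rcases Nat.eq_zero_or_pos n with rfl | hn
  · simp
  have h1 : n < S.q ^ (Nat.log S.q n + 1) := Nat.lt_pow_succ_log_self S.one_lt_q n
  have key : ∀ m, n < S.q ^ m → ∀ m', m ≤ m' →
      ∑ i ∈ Finset.range m, S.uDigit (n / S.q ^ i % S.q) * (S.ϖ : K) ^ (-(i : ℤ)) =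
      ∑ i ∈ Finset.range m', S.uDigit (n / S.q ^ i % S.q) * (S.ϖ : K) ^ (-(i : ℤ)) := by
    intro m hm m' hmm
    refine Finset.sum_subset (Finset.range_mono hmm) fun i _ hi => ?_
    have : S.q ^ m ≤ S.q ^ i := Nat.pow_le_pow_right S.q_pos (by simpa using hi)
    rw [Nat.div_eq_of_lt (hm.trans_le this)]
    simp
  rw [u, key _ h1 _ (le_max_left _ s), key s h _ (le_max_right (Nat.log S.q n + 1) s)]

lemma u_mul_add (n b : ℕ) (hb : b < S.q) :
    S.u (S.q * n + b) = (S.ϖ : K)⁻¹ * S.u n + S.uDigit b := by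
  obtain ⟨s, hs⟩ : ∃ s, n < S.q ^ s := ⟨n, Nat.lt_pow_self S.one_lt_q⟩
  have h2 : S.q * n + b < S.q ^ (s + 1) := by
    rw [pow_succ']
    calc S.q * n + b < S.q * n + S.q := by omega
      _ = S.q * (n + 1) := by ring
      _ ≤ _ := Nat.mul_le_mul_left _ hs
  rw [S.u_eq_sum hs, S.u_eq_sum h2, Finset.sum_range_succ', Finset.mul_sum]
  congr 1
  · refine Finset.sum_congr rfl fun i _ => ?_
    rw [pow_succ', ← Nat.div_div_eq_div_mul, Nat.mul_add_div S.q_pos, Nat.div_eq_of_lt hb, add_zero,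
      mul_left_comm, ← zpow_neg_one, ← zpow_add₀ S.ϖ_ne_zero]
    congr 2
    push_cast; ring
  · simp [Nat.mod_eq_of_lt hb]

lemma u_pow_mul_add (s n b : ℕ) (hb : b < S.q ^ s) :
    S.u (S.q ^ s * n + b) = (S.ϖ : K) ^ (-(s : ℤ)) * S.u n + S.u b := by
  induction s generalizing b with
  | zero => simp at hb; simp [hb]
  | succ s ih =>
    have hb' : b / S.q < S.q ^ s := by
      rw [Nat.div_lt_iff_lt_mul S.q_pos, ← pow_succ]; exact hb
    have hm := Nat.mod_lt b S.q_pos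
    have e1 : S.q ^ (s + 1) * n + b = S.q * (S.q ^ s * n + b / S.q) + b % S.q := by
      conv_lhs => rw [← Nat.div_add_mod b S.q]
      ring
    have e2 : S.u b = (S.ϖ : K)⁻¹ * S.u (b / S.q) + S.uDigit (b % S.q) := by
      conv_lhs => rw [← Nat.div_add_mod b S.q]
      exact S.u_mul_add _ _ hm
    rw [e1, S.u_mul_add _ _ hm, ih _ hb', e2]
    have : (S.ϖ : K) ^ (-((s + 1 : ℕ) : ℤ)) = (S.ϖ : K)⁻¹ * (S.ϖ : K) ^ (-(s : ℤ)) := by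
      rw [← zpow_neg_one, ← zpow_add₀ S.ϖ_ne_zero]; congr 1; push_cast; ring
    rw [this]; ring

lemma u_pow_mul (s n : ℕ) : S.u (S.q ^ s * n) = (S.ϖ : K) ^ (-(s : ℤ)) * S.u n := by
  simpa using S.u_pow_mul_add s n 0 (pow_pos S.q_pos s)

variable [CharP K p]

lemma natCast_integer_eq_zero : ((p : ℕ) : 𝒪[K]) = 0 :=
  Subtype.ext (by simp)

lemma natCast_mod_integer (a : ℕ) : ((a % p : ℕ) : 𝒪[K]) = a := by
  conv_rhs => rw [← Nat.div_add_mod a p]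
  simp

/-- Characteristic `p` enters here: coefficients count only modulo `p`, so sums of digits are again
digits, with no carry. -/
lemma exists_digit_eq (n : Fin S.c → ℕ) :
    ∃ b < S.q, S.digit b = ∑ i, (n i : 𝒪[K]) * S.ε i := by
  let f : Fin S.c → Fin p := fun i => ⟨n i % p, Nat.mod_lt _ hp.out.pos⟩
  refine ⟨finFunctionFinEquiv f, (finFunctionFinEquiv f).2, ?_⟩
  refine Finset.sum_congr rfl fun i _ => ?_
  have : ((finFunctionFinEquiv f : ℕ) / p ^ i.val % p) = n i % p :=
    congrArg Fin.val (congrFun (finFunctionFinEquiv.symm_apply_apply f) i)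
  rw [this, natCast_mod_integer]

lemma exists_digit_add (a b : ℕ) : ∃ d < S.q, S.digit d = S.digit a + S.digit b := by
  obtain ⟨d, hd, h⟩ := S.exists_digit_eq fun i => a / p ^ i.val % p + b / p ^ i.val % p
  refine ⟨d, hd, h.trans ?_⟩
  simp only [Nat.cast_add, add_mul, Finset.sum_add_distrib]
  rfl

lemma exists_residue_digit (x : 𝒪[K]) :
    ∃ b < S.q, IsLocalRing.residue 𝒪[K] (S.digit b) = IsLocalRing.residue 𝒪[K] x := by
  let H : AddSubgroup 𝓀[K] :=
    { carrier := {y | ∃ n : Fin S.c → ℕ, y = IsLocalRing.residue 𝒪[K] (∑ i, (n i : 𝒪[K]) * S.ε i)}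
      zero_mem' := ⟨0, by simp⟩
      add_mem' := by
        rintro _ _ ⟨n, rfl⟩ ⟨m, rfl⟩
        exact ⟨n + m, by simp [add_mul, Finset.sum_add_distrib]⟩
      neg_mem' := by
        rintro _ ⟨n, rfl⟩
        -- In characteristic `p`, multiplication by `p - 1` is negation, so natural coefficients
        -- suffice.
        refine ⟨fun i => (p - 1) * n i, ?_⟩
        rw [← map_neg]
        congr 1
        rw [← Finset.sum_neg_distrib]
        refine Finset.sum_congr rfl fun i _ => ?_
        rw [Nat.cast_mul, Nat.cast_sub hp.out.one_le, natCast_integer_eq_zero (p := p)]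
        simp }
  have hH : (⊤ : AddSubgroup 𝓀[K]) ≤ H := by
    rw [← S.span_residue, AddSubgroup.closure_le]
    rintro _ ⟨i, rfl⟩
    refine ⟨Pi.single i 1, ?_⟩
    simp [Pi.single_apply]
  obtain ⟨n, hn⟩ := hH (AddSubgroup.mem_top (IsLocalRing.residue 𝒪[K] x))
  obtain ⟨b, hb, h⟩ := S.exists_digit_eq n
  exact ⟨b, hb, by rw [h, hn]⟩

/-- A surjection between finite sets of the same cardinality `q` is injective. -/
lemma digit_injOn {a b : ℕ} (ha : a < S.q) (hb : b < S.q)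
    (h : IsLocalRing.residue 𝒪[K] (S.digit a) = IsLocalRing.residue 𝒪[K] (S.digit b)) : a = b := by
  let f : Fin S.q → 𝓀[K] := fun b => IsLocalRing.residue 𝒪[K] (S.digit b)
  have hf : Function.Surjective f := fun y => by
    obtain ⟨x, rfl⟩ := IsLocalRing.residue_surjective y
    obtain ⟨b, hb, h⟩ := S.exists_residue_digit x
    exact ⟨⟨b, hb⟩, h⟩
  have hcard : Nat.card (Fin S.q) = Nat.card 𝓀[K] := by
    rw [Nat.card_fin, S.card_residue]; rfl
  have hf' : Function.Bijective f := hf.bijective_of_nat_card_le hcard.le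
  exact congrArg Fin.val (@hf'.1 ⟨a, ha⟩ ⟨b, hb⟩ h)

lemma residue_eq_iff (x y : 𝒪[K]) :
    IsLocalRing.residue 𝒪[K] x = IsLocalRing.residue 𝒪[K] y ↔
      (S.ϖ : K)⁻¹ * ((x : K) - y) ∈ 𝒪[K] := by
  rw [← sub_eq_zero, ← map_sub, IsLocalRing.residue_eq_zero_iff,
    S.irreducible_ϖ.maximalIdeal_eq, Ideal.mem_span_singleton]
  constructor
  · rintro ⟨z, hz⟩
    have : ((x : K) - y) = S.ϖ * z := by
      simpa using congrArg (Subtype.val) hz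
    rw [this, inv_mul_cancel_left₀ S.ϖ_ne_zero]
    exact z.2
  · intro h
    refine ⟨⟨_, h⟩, Subtype.ext ?_⟩
    simp [S.ϖ_ne_zero]

lemma ϖ_mul_mem {x : K} (h : x ∈ 𝒪[K]) : (S.ϖ : K) * x ∈ 𝒪[K] := mul_mem S.ϖ.2 h

/-- Multiplication by `ϖ` strips the last base-`q` digit modulo `𝔇`, so the higher digits agree by
induction. What remains is `ϖ⁻¹` times a difference of digits, which is integral only if their
residues agree. -/
lemma eq_of_u_sub_u_mem {a b : ℕ} (h : S.u a - S.u b ∈ 𝒪[K]) : a = b := by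
  induction a using Nat.strong_induction_on generalizing b with
  | _ a ih =>
  have hϖ := S.ϖ_ne_zero
  have key : ∀ a, S.u a = (S.ϖ : K)⁻¹ * (S.u (a / S.q) + S.digit (a % S.q)) := fun a => by
    conv_lhs => rw [← Nat.div_add_mod a S.q, S.u_mul_add _ _ (Nat.mod_lt _ S.q_pos), uDigit_eq]
    ring
  have h1 : S.u (a / S.q) - S.u (b / S.q) ∈ 𝒪[K] := by
    have e : S.u (a / S.q) - S.u (b / S.q) =
        S.ϖ * (S.u a - S.u b) + (S.digit (b % S.q) - S.digit (a % S.q) : 𝒪[K]) := by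
      rw [key a, key b, ← mul_sub, mul_inv_cancel_left₀ hϖ]; push_cast; ring
    rw [e]
    exact add_mem (S.ϖ_mul_mem h) (Subtype.prop _)
  have h2 : a / S.q = b / S.q := by
    rcases Nat.eq_zero_or_pos a with rfl | ha
    · by_contra hne
      -- Division by `q` does not decrease `a = 0`, so this case needs its own induction on `b`.
      have : ∀ b, S.u 0 - S.u b ∈ 𝒪[K] → 0 = b := by
        intro b
        induction b using Nat.strong_induction_on with
        | _ b ihb =>
        intro hb
        by_contra hb0
        have e : S.u 0 - S.u (b / S.q) =
            S.ϖ * (S.u 0 - S.u b) + (S.digit (b % S.q) : 𝒪[K]) := by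
          rw [key b, u_zero, zero_sub, zero_sub, mul_neg, mul_inv_cancel_left₀ hϖ]; ring
        have h3 := ihb (b / S.q) (Nat.div_lt_self (by omega) S.one_lt_q)
          (e ▸ add_mem (S.ϖ_mul_mem hb) (Subtype.prop _))
        have h4 : S.u 0 - S.u b = -((S.ϖ : K)⁻¹ * ((S.digit (b % S.q) : K) - S.digit 0)) := by
          rw [key b, ← h3]; simp
        rw [h4, neg_mem_iff, ← residue_eq_iff] at hb
        have := S.digit_injOn (Nat.mod_lt _ S.q_pos) S.q_pos hb
        have := Nat.div_add_mod b S.q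
        rw [← h3] at this
        simp at this
        omega
      have := this b h
      subst this
      exact hne rfl
    · exact ih _ (Nat.div_lt_self ha S.one_lt_q) h1
  have h3 : S.u a - S.u b = (S.ϖ : K)⁻¹ * ((S.digit (a % S.q) : K) - S.digit (b % S.q)) := by
    rw [key a, key b, h2]; ring
  rw [h3, ← residue_eq_iff] at h
  have h4 := S.digit_injOn (Nat.mod_lt _ S.q_pos) (Nat.mod_lt _ S.q_pos) h
  rw [← Nat.div_add_mod a S.q, ← Nat.div_add_mod b S.q, h2, h4]

lemma u_injective : Function.Injective S.u := fun a b h =>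
  S.eq_of_u_sub_u_mem (by rw [h, sub_self]; exact zero_mem _)

lemma exists_u_add {N : ℕ} {a b : ℕ} (ha : a < S.q ^ N) (hb : b < S.q ^ N) :
    ∃ d < S.q ^ N, S.u d = S.u a + S.u b := by
  induction N generalizing a b with
  | zero =>
    simp only [pow_zero, Nat.lt_one_iff] at ha hb
    exact ⟨0, by simp, by simp [ha, hb]⟩
  | succ N ih =>
    have hq : ∀ {a}, a < S.q ^ (N + 1) → a / S.q < S.q ^ N := fun {a} ha => by
      rw [Nat.div_lt_iff_lt_mul S.q_pos, ← pow_succ]; exact ha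
    obtain ⟨d, hd, h⟩ := ih (hq ha) (hq hb)
    obtain ⟨e, he, h'⟩ := S.exists_digit_add (a % S.q) (b % S.q)
    refine ⟨S.q * d + e, ?_, ?_⟩
    · calc S.q * d + e < S.q * d + S.q := by omega
        _ = S.q * (d + 1) := by ring
        _ ≤ S.q * S.q ^ N := Nat.mul_le_mul_left _ hd
        _ = _ := (pow_succ' _ _).symm
    · rw [S.u_mul_add _ _ he, h, uDigit_eq, h']
      conv_rhs => rw [← Nat.div_add_mod a S.q, ← Nat.div_add_mod b S.q,
        S.u_mul_add _ _ (Nat.mod_lt _ S.q_pos), S.u_mul_add _ _ (Nat.mod_lt _ S.q_pos),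
        uDigit_eq, uDigit_eq]
      push_cast; ring

lemma exists_u_neg {N : ℕ} {a : ℕ} (ha : a < S.q ^ N) :
    ∃ d < S.q ^ N, S.u d = - S.u a := by
  have : ∀ m : ℕ, ∃ d < S.q ^ N, S.u d = m * S.u a := by
    intro m
    induction m with
    | zero => exact ⟨0, pow_pos S.q_pos _, by simp⟩
    | succ m ih =>
      obtain ⟨d, hd, h⟩ := ih
      obtain ⟨e, he, h'⟩ := S.exists_u_add hd ha
      exact ⟨e, he, by rw [h', h]; push_cast; ring⟩
  -- The opposite of an element is its `(p - 1)`-fold sum.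
  obtain ⟨d, hd, h⟩ := this (p - 1)
  refine ⟨d, hd, ?_⟩
  rw [h, Nat.cast_sub hp.out.one_le, CharP.cast_eq_zero]
  simp

/-- Translation by `u n` permutes the translation set and, for large `N`, its first `q ^ N`
elements. -/
lemma exists_perm_u_add (n : ℕ) : ∃ σ : Equiv.Perm ℕ, (∀ k, S.u (σ k) = S.u k + S.u n) ∧
    ∀ N, n < S.q ^ N → ∀ k, σ k < S.q ^ N ↔ k < S.q ^ N := by
  have hN : ∀ a b : ℕ, ∃ N, a < S.q ^ N ∧ b < S.q ^ N := fun a b =>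
    ⟨max a b, (le_max_left a b).trans_lt (Nat.lt_pow_self S.one_lt_q),
      (le_max_right a b).trans_lt (Nat.lt_pow_self S.one_lt_q)⟩
  have hadd : ∀ a b, ∃ d, S.u d = S.u a + S.u b := fun a b => by
    obtain ⟨N, ha, hb⟩ := hN a b
    obtain ⟨d, -, h⟩ := S.exists_u_add ha hb
    exact ⟨d, h⟩
  have hneg : ∃ n', S.u n' = - S.u n := by
    obtain ⟨N, ha, -⟩ := hN n n
    obtain ⟨d, -, h⟩ := S.exists_u_neg ha
    exact ⟨d, h⟩
  obtain ⟨n', hn'⟩ := hneg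
  choose f hf using fun k => hadd k n
  choose g hg using fun k => hadd k n'
  let σ : Equiv.Perm ℕ :=
    { toFun := f
      invFun := g
      left_inv := fun k => S.u_injective (by rw [hg, hf, hn']; ring)
      right_inv := fun k => S.u_injective (by rw [hf, hg, hn']; ring) }
  refine ⟨σ, hf, fun N hnN k => ⟨fun h => ?_, fun h => ?_⟩⟩
  · obtain ⟨m, hm, e⟩ := S.exists_u_neg hnN
    obtain ⟨d, hd, e'⟩ := S.exists_u_add h hm
    have : d = k := S.u_injective (by rw [e', e]; change S.u (f k) + _ = _; rw [hf]; ring)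
    exact this ▸ hd
  · obtain ⟨d, hd, e'⟩ := S.exists_u_add h hnN
    have : d = f k := S.u_injective (by rw [e', hf])
    change f k < _
    exact this ▸ hd

lemma tsum_u_add {M : Type*} [AddCommMonoid M] [TopologicalSpace M] (G : K → M) (n : ℕ) :
    ∑' k, G (S.u k + S.u n) = ∑' k, G (S.u k) := by
  obtain ⟨σ, hσ, -⟩ := S.exists_perm_u_add n
  simp_rw [← hσ]
  exact σ.tsum_eq (fun k => G (S.u k))

lemma sum_u_add {M : Type*} [AddCommMonoid M] (G : K → M) {n N : ℕ} (hn : n < S.q ^ N) :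
    ∑ k ∈ Finset.range (S.q ^ N), G (S.u k + S.u n) = ∑ k ∈ Finset.range (S.q ^ N), G (S.u k) := by
  obtain ⟨σ, hσ, h⟩ := S.exists_perm_u_add n
  simp_rw [← hσ]
  exact Finset.sum_equiv σ (by simpa using fun i => (h N hn i).symm) (fun _ _ => rfl)

lemma pow_mul_u_mem {N b : ℕ} (hb : b < S.q ^ N) : (S.ϖ : K) ^ N * S.u b ∈ 𝒪[K] := by
  induction N generalizing b with
  | zero => simp at hb; simp [hb]
  | succ N ih =>
    have hq : b / S.q < S.q ^ N := by
      rw [Nat.div_lt_iff_lt_mul S.q_pos, ← pow_succ]; exact hb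
    have e : (S.ϖ : K) ^ (N + 1) * S.u b =
        S.ϖ ^ N * S.u (b / S.q) + S.ϖ ^ N * S.digit (b % S.q) := by
      conv_lhs => rw [← Nat.div_add_mod b S.q, S.u_mul_add _ _ (Nat.mod_lt _ S.q_pos), uDigit_eq]
      have := S.ϖ_ne_zero
      field_simp
      ring
    rw [e]
    exact add_mem (ih hq) (mul_mem (pow_mem S.ϖ.2 _) (Subtype.prop _))

lemma exists_sub_u_mem {N : ℕ} {x : K} (hx : (S.ϖ : K) ^ N * x ∈ 𝒪[K]) :
    ∃ b < S.q ^ N, x - S.u b ∈ 𝒪[K] := by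
  induction N generalizing x with
  | zero => exact ⟨0, by simp, by simpa using hx⟩
  | succ N ih =>
    obtain ⟨b, hb, h⟩ := ih (x := S.ϖ * x) (by rwa [← mul_assoc, ← pow_succ])
    obtain ⟨a, ha, h'⟩ := S.exists_residue_digit ⟨_, h⟩
    refine ⟨S.q * b + a, ?_, ?_⟩
    · calc S.q * b + a < S.q * b + S.q := by omega
        _ = S.q * (b + 1) := by ring
        _ ≤ S.q * S.q ^ N := Nat.mul_le_mul_left _ hb
        _ = _ := (pow_succ' _ _).symm
    · have := (S.residue_eq_iff _ _).1 h'.symm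
      rw [S.u_mul_add _ _ ha, uDigit_eq]
      convert this using 1
      have := S.ϖ_ne_zero
      field_simp
      ring

lemma exists_pow_mul_mem (x : K) : ∃ N : ℕ, (S.ϖ : K) ^ N * x ∈ 𝒪[K] := by
  by_cases hx : x ∈ 𝒪[K]
  · exact ⟨0, by simpa using hx⟩
  have hx0 : x ≠ 0 := fun h => hx (h ▸ zero_mem _)
  have hx' : x⁻¹ ∈ 𝒪[K] := by
    have h1 : 1 < valuation K x := lt_of_not_ge hx
    change valuation K x⁻¹ ≤ 1
    rw [map_inv₀]
    exact inv_le_one_of_one_le₀ h1.le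
  have hy : (⟨x⁻¹, hx'⟩ : 𝒪[K]) ≠ 0 := fun h => inv_ne_zero hx0 (congrArg Subtype.val h)
  obtain ⟨N, w, hw⟩ := IsDiscreteValuationRing.associated_pow_irreducible hy S.irreducible_ϖ
  refine ⟨N, ?_⟩
  have h : x⁻¹ * ((w : 𝒪[K]) : K) = (S.ϖ : K) ^ N := by
    simpa using congrArg Subtype.val hw
  rw [← h]
  convert (w : 𝒪[K]).2 using 1
  field_simp

lemma pow_mul_mem_of_le {x : K} {m n : ℤ} (h : (S.ϖ : K) ^ m * x ∈ 𝒪[K]) (hmn : m ≤ n) :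
    (S.ϖ : K) ^ n * x ∈ 𝒪[K] := by
  obtain ⟨d, rfl⟩ := Int.le.dest hmn
  rw [add_comm, zpow_add₀ S.ϖ_ne_zero, mul_assoc, zpow_natCast]
  exact mul_mem (pow_mem S.ϖ.2 _) h

lemma tendsto_pow_mul (z : ℕ → K) (hz : ∀ n, z n ∈ 𝒪[K]) :
    Filter.Tendsto (fun n : ℕ => (S.ϖ : K) ^ n * z n) Filter.atTop (nhds 0) := by
  rw [(IsValuativeTopology.hasBasis_nhds_zero' K).tendsto_right_iff]
  intro γ hγ
  obtain ⟨a, rfl⟩ := ValuativeRel.valuation_surjective γ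
  have ha : a ≠ 0 := by simpa using hγ
  obtain ⟨N, hN⟩ := S.exists_pow_mul_mem (a⁻¹)
  -- Taking `n > N` strictly leaves a spare factor `ϖ`, which makes the final inequality strict.
  filter_upwards [Filter.eventually_gt_atTop N] with n hn
  have hϖ : valuation K (S.ϖ : K) < 1 := by
    refine lt_of_le_of_ne S.ϖ.2 fun h => S.irreducible_ϖ.not_isUnit ?_
    refine IsUnit.of_mul_eq_one ⟨(S.ϖ : K)⁻¹, ?_⟩ (Subtype.ext ?_)
    · change valuation K _ ≤ 1
      rw [map_inv₀, h, inv_one]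
    · simp [S.ϖ_ne_zero]
  obtain ⟨d, rfl⟩ := Nat.exists_eq_add_of_lt hn
  have h1 : valuation K ((S.ϖ : K) ^ N * a⁻¹) ≤ 1 := hN
  have e : (S.ϖ : K) ^ (N + d + 1) * z (N + d + 1) =
      (S.ϖ ^ N * a⁻¹) * (S.ϖ ^ d * z (N + d + 1)) * S.ϖ * a := by
    field_simp; ring
  have h2 : valuation K ((S.ϖ : K) ^ d * z (N + d + 1)) ≤ 1 :=
    mul_mem (pow_mem S.ϖ.2 _) (hz _)
  change valuation K _ < valuation K a
  rw [e, map_mul, map_mul, map_mul]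
  have h3 : valuation K ((S.ϖ : K) ^ N * a⁻¹) * valuation K ((S.ϖ : K) ^ d * z (N + d + 1)) *
      valuation K (S.ϖ : K) < 1 := lt_of_le_of_lt (mul_le_of_le_one_left' (mul_le_one' h1 h2)) hϖ
  calc _ < 1 * valuation K a := mul_lt_mul_of_pos_right h3 (zero_lt_iff.2 hγ)
    _ = _ := one_mul _

/-- Choose `u (b n)` in the coset of `ϖ^{-n} y` modulo `𝔇`; scaling back by `ϖ^n` leaves an error in
`ϖ^n 𝔇`. -/
lemma exists_tendsto_u (y : K) : ∃ b : ℕ → ℕ,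
    Filter.Tendsto (fun n : ℕ => (S.ϖ : K) ^ n * S.u (b n)) Filter.atTop (nhds y) := by
  have : ∀ n : ℕ, ∃ b, (S.ϖ : K) ^ (-(n : ℤ)) * y - S.u b ∈ 𝒪[K] := fun n => by
    obtain ⟨N, hN⟩ := S.exists_pow_mul_mem ((S.ϖ : K) ^ (-(n : ℤ)) * y)
    obtain ⟨b, -, h⟩ := S.exists_sub_u_mem hN
    exact ⟨b, h⟩
  choose b hb using this
  refine ⟨b, ?_⟩
  have h := (tendsto_const_nhds (x := y)).sub (S.tendsto_pow_mul _ hb)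
  rw [sub_zero] at h
  refine h.congr fun n => ?_
  rw [mul_sub, zpow_neg, zpow_natCast, mul_inv_cancel_left₀ (pow_ne_zero _ S.ϖ_ne_zero)]
  ring

end Arithmetic

end LatticeData

/-! ### Translations, local energies and restrictions in `L²(K)`. -/

section Translation

variable {K : Type*} [Field K] [ValuativeRel K] [TopologicalSpace K] [IsNonarchimedeanLocalField K]
  [MeasurableSpace K] [BorelSpace K]

lemma isOpen_integer : IsOpen (𝒪[K] : Set K) := by
  refine AddSubgroup.isOpen_of_mem_nhds (Subring.toAddSubgroup 𝒪[K]) (g := 0) ?_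
  refine Filter.mem_of_superset
    ((IsValuativeTopology.hasBasis_nhds_zero' K).mem_of_mem (i := 1) one_ne_zero) ?_
  intro x hx
  exact le_of_lt (show valuation K x < 1 from hx)

lemma measurableSet_integer : MeasurableSet (𝒪[K] : Set K) := isOpen_integer.measurableSet

lemma translation_ae (y : K) (f : L2 K) : translation y f =ᵐ[haar K] fun x => f (x - y) :=
  Lp.coeFn_compMeasurePreserving _ _

lemma translation_translation (y z : K) (f : L2 K) :
    translation y (translation z f) = translation (y + z) f := by
  refine Lp.ext ?_
  filter_upwards [translation_ae y (translation z f), translation_ae (y + z) f,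
    (measurePreserving_sub_right (haar K) y).quasiMeasurePreserving.ae (translation_ae z f)]
    with x h1 h2 h3
  rw [h1, h2, h3, sub_sub]

@[simp] lemma translation_zero (f : L2 K) : translation 0 f = f := by
  refine Lp.ext ?_
  filter_upwards [translation_ae 0 f] with x h1
  rw [h1, sub_zero]

lemma translation_add (y : K) (f g : L2 K) :
    translation y (f + g) = translation y f + translation y g :=
  map_add (Lp.compMeasurePreserving _ _) f g

lemma norm_translation (y : K) (f : L2 K) : ‖translation y f‖ = ‖f‖ :=
  Lp.norm_compMeasurePreserving _ _

lemma enorm_translation (y : K) (f : L2 K) : ‖translation y f‖ₑ = ‖f‖ₑ :=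
  enorm_eq_iff_norm_eq.2 (norm_translation y f)

lemma ip_translation (y : K) (f g : L2 K) :
    ip (translation y f) (translation y g) = ip f g :=
  (Lp.compMeasurePreservingₗᵢ ℂ (fun x => x - y)
    (measurePreserving_sub_right (haar K) y)).inner_map_map g f

lemma ip_translation_left (y z : K) (f g : L2 K) :
    ip (translation y f) (translation z g) = ip f (translation (z - y) g) := by
  rw [← ip_translation (-y), translation_translation, translation_translation]
  simp [sub_eq_neg_add]

lemma ip_translation_right (y z : K) (f g : L2 K) :
    ip (translation z f) (translation y g) = ip (translation (z - y) f) g := by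
  rw [← ip_translation (-y), translation_translation, translation_translation]
  simp [sub_eq_neg_add]

lemma continuous_translation (f : L2 K) : Continuous fun y => translation y f := by
  let φ : K → C(K, K) := fun y => ⟨fun x => x - y, by fun_prop⟩
  have hφ : Continuous φ := by
    refine ContinuousMap.continuous_of_continuous_uncurry _ ?_
    change Continuous fun z : K × K => z.2 - z.1
    fun_prop
  exact Continuous.compMeasurePreservingLp (continuous_const (y := f)) hφ
    (fun y => measurePreserving_sub_right (haar K) y) ENNReal.ofNat_ne_top

lemma ip_add_left (f g h : L2 K) : ip (f + g) h = ip f h + ip g h := inner_add_right _ _ _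

lemma ip_smul_right (c : ℂ) (f g : L2 K) : ip f (c • g) = (starRingEnd ℂ) c * ip f g :=
  inner_smul_left _ _ _

lemma ip_smul_left (c : ℂ) (f g : L2 K) : ip (c • f) g = c * ip f g :=
  inner_smul_right _ _ _

lemma ip_conj (f g : L2 K) : (starRingEnd ℂ) (ip f g) = ip g f := inner_conj_symm _ _

lemma enorm_ip_comm (f g : L2 K) : ‖ip f g‖ₑ = ‖ip g f‖ₑ :=
  enorm_eq_iff_norm_eq.2 (norm_inner_symm _ _)

/-- The measure `‖f‖² dx`. -/
noncomputable def energy (f : L2 K) : Measure K := (haar K).withDensity fun x => ‖f x‖ₑ ^ 2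

lemma energy_apply (f : L2 K) {E : Set K} (hE : MeasurableSet E) :
    energy f E = ∫⁻ x in E, ‖f x‖ₑ ^ 2 ∂(haar K) := withDensity_apply _ hE

lemma eLpNorm_two_sq (f : K → ℂ) : eLpNorm f 2 (haar K) ^ 2 = ∫⁻ x, ‖f x‖ₑ ^ 2 ∂(haar K) := by
  rw [eLpNorm_eq_lintegral_rpow_enorm_toReal two_ne_zero ENNReal.ofNat_ne_top, ← ENNReal.rpow_two,
    ← ENNReal.rpow_mul]
  simp

lemma energy_univ (f : L2 K) : energy f Set.univ = ‖f‖ₑ ^ 2 := by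
  rw [energy_apply f MeasurableSet.univ, Lp.enorm_def, eLpNorm_two_sq, Measure.restrict_univ]

instance (f : L2 K) : IsFiniteMeasure (energy f) :=
  ⟨by rw [energy_univ]; exact ENNReal.pow_lt_top enorm_lt_top⟩

lemma energy_translation (y : K) (f : L2 K) {E : Set K} (hE : MeasurableSet E) :
    energy (translation y f) E = energy f ((fun x => x + y) ⁻¹' E) := by
  have hm : MeasurableSet ((fun x => x + y) ⁻¹' E) := (measurable_add_const y) hE
  rw [energy_apply _ hE, energy_apply _ hm, ← lintegral_indicator hE, ← lintegral_indicator hm,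
    ← lintegral_sub_right_eq_self (((fun x => x + y) ⁻¹' E).indicator fun x => ‖f x‖ₑ ^ 2) y]
  refine lintegral_congr_ae ?_
  filter_upwards [translation_ae y f] with x hx
  by_cases h : x ∈ E <;> simp [Set.indicator, h, hx]

/-- The product of `f` with the indicator function of `E`. -/
noncomputable def restr (E : Set K) (hE : MeasurableSet E) (f : L2 K) : L2 K :=
  ((Lp.memLp f).indicator hE).toLp

lemma restr_ae (E : Set K) (hE : MeasurableSet E) (f : L2 K) :
    restr E hE f =ᵐ[haar K] E.indicator f := MemLp.coeFn_toLp _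

lemma enorm_restr_sq (E : Set K) (hE : MeasurableSet E) (f : L2 K) :
    ‖restr E hE f‖ₑ ^ 2 = energy f E := by
  rw [restr, Lp.enorm_toLp, eLpNorm_two_sq, energy_apply f hE, ← lintegral_indicator hE]
  refine lintegral_congr fun x => ?_
  by_cases h : x ∈ E <;> simp [h]

/-- `f` vanishes almost everywhere outside `E`. -/
def SupportedOn (f : L2 K) (E : Set K) : Prop := ∀ᵐ x ∂(haar K), x ∉ E → f x = 0

lemma supportedOn_restr (E : Set K) (hE : MeasurableSet E) (f : L2 K) :
    SupportedOn (restr E hE f) E := by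
  filter_upwards [restr_ae E hE f] with x hx h
  simp [hx, h]

lemma SupportedOn.translation {f : L2 K} {E : Set K} (h : SupportedOn f E) (y : K) :
    SupportedOn (translation y f) ((fun x => x - y) ⁻¹' E) := by
  filter_upwards [translation_ae y f,
    (measurePreserving_sub_right (haar K) y).quasiMeasurePreserving.ae h] with x h1 h2 h3
  rw [h1]
  exact h2 h3

/-- Cauchy–Schwarz after replacing `g` by its restriction to `E`. -/
lemma SupportedOn.enorm_ip_sq_le {f : L2 K} {E : Set K} (h : SupportedOn f E)
    (hE : MeasurableSet E) (g : L2 K) : ‖ip f g‖ₑ ^ 2 ≤ ‖f‖ₑ ^ 2 * energy g E := by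
  have h1 : ip f g = ip f (restr E hE g) := by
    rw [ip_eq_integral, ip_eq_integral]
    refine integral_congr_ae ?_
    filter_upwards [h, restr_ae E hE g] with x h1 h2
    by_cases hx : x ∈ E
    · simp [h2, hx]
    · simp [h1 hx]
  rw [h1, ← enorm_restr_sq E hE, ← mul_pow]
  gcongr
  rw [mul_comm]
  have h2 := nnnorm_inner_le_nnnorm (𝕜 := ℂ) (restr E hE g) f
  simp only [ip, enorm_eq_nnnorm]
  exact_mod_cast h2

lemma restr_add_restr_compl (E : Set K) (hE : MeasurableSet E) (f : L2 K) :
    restr E hE f + restr Eᶜ hE.compl f = f := by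
  refine Lp.ext ?_
  filter_upwards [Lp.coeFn_add (restr E hE f) (restr Eᶜ hE.compl f), restr_ae E hE f,
    restr_ae Eᶜ hE.compl f] with x h1 h2 h3
  rw [h1, Pi.add_apply, h2, h3]
  by_cases h : x ∈ E <;> simp [h]

lemma restr_eq_sum {ι : Type*} (s : Finset ι) (E : ι → Set K) (hE : ∀ i, MeasurableSet (E i))
    (hd : (s : Set ι).PairwiseDisjoint E) (F : Set K) (hF : MeasurableSet F)
    (hEF : F = ⋃ i ∈ s, E i) (f : L2 K) :
    restr F hF f = ∑ i ∈ s, restr (E i) (hE i) f := by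
  refine Lp.ext ?_
  have h : ∀ᵐ x ∂(haar K), ∀ i ∈ s, restr (E i) (hE i) f x = (E i).indicator f x :=
    (Finset.eventually_all s).2 fun i _ => restr_ae (E i) (hE i) f
  filter_upwards [Lp.coeFn_finsetSum s (fun i => restr (E i) (hE i) f), restr_ae F hF f, h]
    with x h1 h2 h3
  rw [h1, h2, Finset.sum_apply, Finset.sum_congr rfl h3, hEF]
  exact (Finset.indicator_biUnion_apply s E hd x)

/-- The coset `y + 𝔇`. -/
def coset (y : K) : Set K := (fun x => x - y) ⁻¹' 𝒪[K]

lemma measurableSet_coset (y : K) : MeasurableSet (coset y) :=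
  (measurable_sub_const y) measurableSet_integer

lemma haar_coset (y : K) : haar K (coset y) = 1 := by
  rw [coset, (measurePreserving_sub_right (haar K) y).measure_preimage
    measurableSet_integer.nullMeasurableSet, haar_integer]

end Translation

/-! ### Fractional ideals, scaling of Haar measure and dilations. -/

namespace LatticeData

variable {K : Type*} [Field K] [ValuativeRel K] [TopologicalSpace K] [IsNonarchimedeanLocalField K]
  [MeasurableSpace K] [BorelSpace K] {p : ℕ} (S : LatticeData K p)

/-- The fractional ideal `ϖ^{-n} 𝔇`. -/
def ball (n : ℤ) : Set K := {x | (S.ϖ : K) ^ n * x ∈ 𝒪[K]}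

variable [hp : Fact p.Prime] [CharP K p]

lemma ball_zero : S.ball 0 = 𝒪[K] := by ext; simp [ball]

lemma measurableSet_ball (n : ℤ) : MeasurableSet (S.ball n) :=
  (measurable_const_mul ((S.ϖ : K) ^ n)) measurableSet_integer

lemma ball_mono : Monotone S.ball := fun _ _ hmn _ hx => S.pow_mul_mem_of_le hx hmn

lemma mul_preimage_ball (j n : ℤ) : (fun x => (S.ϖ : K) ^ j * x) ⁻¹' S.ball n = S.ball (n + j) := by
  ext x
  simp [ball, zpow_add₀ S.ϖ_ne_zero, mul_assoc]

lemma iUnion_ball : ⋃ n : ℕ, S.ball n = Set.univ := by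
  refine Set.eq_univ_of_forall fun x => ?_
  obtain ⟨N, hN⟩ := S.exists_pow_mul_mem x
  exact Set.mem_iUnion.2 ⟨N, by simpa [ball] using hN⟩

lemma disjoint_coset {a b : ℕ} (h : a ≠ b) : Disjoint (coset (S.u a)) (coset (S.u b)) := by
  refine Set.disjoint_left.2 fun x ha hb => h (S.eq_of_u_sub_u_mem ?_)
  have := sub_mem (show x - S.u b ∈ 𝒪[K] from hb) (show x - S.u a ∈ 𝒪[K] from ha)
  rwa [sub_sub_sub_cancel_left] at this

lemma disjoint_coset_neg {a b : ℕ} (h : a ≠ b) :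
    Disjoint (coset (-S.u a)) (coset (-S.u b)) := by
  refine Set.disjoint_left.2 fun x ha hb => h (S.eq_of_u_sub_u_mem ?_)
  have := sub_mem (show x - -S.u a ∈ 𝒪[K] from ha) (show x - -S.u b ∈ 𝒪[K] from hb)
  simpa using this

lemma ball_eq_biUnion (N : ℕ) : S.ball N = ⋃ b ∈ Finset.range (S.q ^ N), coset (S.u b) := by
  ext x
  simp only [Set.mem_iUnion, Finset.mem_range]
  constructor
  · intro hx
    obtain ⟨b, hb, h⟩ := S.exists_sub_u_mem (show (S.ϖ : K) ^ N * x ∈ 𝒪[K] by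
      simpa [ball] using hx)
    exact ⟨b, hb, h⟩
  · rintro ⟨b, hb, h⟩
    have h1 : (S.ϖ : K) ^ N * (x - S.u b) ∈ 𝒪[K] := mul_mem (pow_mem S.ϖ.2 _) h
    have := add_mem h1 (S.pow_mul_u_mem hb)
    rw [← mul_add, sub_add_cancel] at this
    simpa [ball] using this

lemma haar_ball (N : ℕ) : haar K (S.ball N) = (S.q : ℝ≥0∞) ^ N := by
  rw [ball_eq_biUnion, measure_biUnion_finset (fun a _ b _ h => S.disjoint_coset h)
    (fun b _ => measurableSet_coset _)]
  simp [haar_coset]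

/-- The pushforward is again a Haar measure, hence a multiple of `haar K`. For `n ≥ 0` the factor is
its value on `𝔇`, that is, the measure `q ^ n` of `ϖ^{-n} 𝔇`. Negative exponents follow by applying
the inverse map. -/
lemma map_mul_haar (n : ℤ) :
    Measure.map (fun x => (S.ϖ : K) ^ n * x) (haar K) = ((S.q : ℝ≥0∞) ^ n) • haar K := by
  have hq0 : (S.q : ℝ≥0∞) ≠ 0 := by exact_mod_cast S.q_pos.ne'
  have hqt : (S.q : ℝ≥0∞) ≠ ∞ := ENNReal.natCast_ne_top _
  have key : ∀ N : ℕ, Measure.map (fun x => (S.ϖ : K) ^ (N : ℤ) * x) (haar K) =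
      ((S.q : ℝ≥0∞) ^ (N : ℤ)) • haar K := by
    intro N
    have ha : (S.ϖ : K) ^ (N : ℤ) ≠ 0 := zpow_ne_zero _ S.ϖ_ne_zero
    let e : K ≃ₜ+ K :=
      { toFun := fun x => (S.ϖ : K) ^ (N : ℤ) * x
        invFun := fun x => ((S.ϖ : K) ^ (N : ℤ))⁻¹ * x
        left_inv := fun x => inv_mul_cancel_left₀ ha x
        right_inv := fun x => mul_inv_cancel_left₀ ha x
        map_add' := fun x y => mul_add _ x y
        continuous_toFun := continuous_const_mul _
        continuous_invFun := continuous_const_mul _ }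
    have : (Measure.map e (haar K)).IsAddHaarMeasure := e.isAddHaarMeasure_map (haar K)
    have : (Measure.map e (haar K)).Regular := Measure.Regular.map e.toHomeomorph
    have h := Measure.isAddLeftInvariant_eq_smul_of_regular (Measure.map e (haar K)) (haar K)
    have h1 := congrArg (fun μ => μ (𝒪[K] : Set K)) h
    simp only [Measure.smul_apply, haar_integer] at h1
    rw [Measure.map_apply (f := e) (measurable_const_mul _) measurableSet_integer] at h1
    change haar K (S.ball N) = _ at h1
    rw [haar_ball] at h1
    change Measure.map e (haar K) = _
    rw [h]
    ext E hE
    rw [Measure.smul_apply, Measure.smul_apply, zpow_natCast, h1]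
    simp [ENNReal.smul_def]
  obtain ⟨N, rfl | rfl⟩ := n.eq_nat_or_neg
  · exact key N
  · have h := congrArg (Measure.map (fun x => (S.ϖ : K) ^ (-(N : ℤ)) * x)) (key N)
    rw [Measure.map_map (measurable_const_mul _) (measurable_const_mul _), Measure.map_smul] at h
    have hid : ((fun x => (S.ϖ : K) ^ (-(N : ℤ)) * x) ∘ fun x => (S.ϖ : K) ^ (N : ℤ) * x) = id := by
      ext x
      simp only [Function.comp, ← mul_assoc, ← zpow_add₀ S.ϖ_ne_zero]
      simp
    rw [hid, Measure.map_id] at h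
    conv_rhs => rw [h]
    rw [smul_smul, ← ENNReal.zpow_add hq0 hqt, neg_add_cancel, zpow_zero, one_smul]

lemma quasiMeasurePreserving_mul (n : ℤ) :
    Measure.QuasiMeasurePreserving (fun x => (S.ϖ : K) ^ n * x) (haar K) (haar K) :=
  ⟨measurable_const_mul _, by rw [map_mul_haar]; exact Measure.smul_absolutelyContinuous⟩

lemma dilation_ae (j : ℤ) (f : L2 K) : S.dilation j f =ᵐ[haar K]
    fun x => (((S.q : ℝ) ^ ((j : ℝ) / 2) : ℝ) : ℂ) * f ((S.ϖ : K) ^ (-j) * x) := by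
  filter_upwards [Lp.coeFn_smul (((S.q : ℝ) ^ ((j : ℝ) / 2) : ℝ) : ℂ)
    (memLp_comp_mul (zpow_ne_zero (-j) S.ϖ_ne_zero) f).toLp,
    (memLp_comp_mul (zpow_ne_zero (-j) S.ϖ_ne_zero) f).coeFn_toLp] with x h1 h2
  rw [dilation, h1, Pi.smul_apply, h2, smul_eq_mul]

lemma q_pos_real : (0 : ℝ) < S.q := by exact_mod_cast S.q_pos

lemma dilation_dilation (i j : ℤ) (f : L2 K) :
    S.dilation i (S.dilation j f) = S.dilation (i + j) f := by
  refine Lp.ext ?_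
  filter_upwards [S.dilation_ae i (S.dilation j f), S.dilation_ae (i + j) f,
    (S.quasiMeasurePreserving_mul (-i)).ae (S.dilation_ae j f)] with x h1 h2 h3
  rw [h1, h2, h3, ← mul_assoc, ← mul_assoc, ← zpow_add₀ S.ϖ_ne_zero, ← Complex.ofReal_mul,
    ← Real.rpow_add S.q_pos_real]
  congr 4
  · push_cast; ring
  · ring

@[simp] lemma dilation_zero (f : L2 K) : S.dilation 0 f = f := by
  refine Lp.ext ?_
  filter_upwards [S.dilation_ae 0 f] with x h1
  simp [h1]

lemma dilation_translation (j : ℤ) (y : K) (f : L2 K) :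
    S.dilation j (translation y f) = translation ((S.ϖ : K) ^ j * y) (S.dilation j f) := by
  refine Lp.ext ?_
  filter_upwards [S.dilation_ae j (translation y f), translation_ae ((S.ϖ : K) ^ j * y)
    (S.dilation j f), (S.quasiMeasurePreserving_mul (-j)).ae (translation_ae y f),
    (measurePreserving_sub_right (haar K)
      ((S.ϖ : K) ^ j * y)).quasiMeasurePreserving.ae (S.dilation_ae j f)] with x h1 h2 h3 h4
  rw [h1, h2, h3, h4, mul_sub, ← mul_assoc, ← zpow_add₀ S.ϖ_ne_zero]
  simp

lemma sq_rpow_half (j : ℤ) : ((S.q : ℝ) ^ ((j : ℝ) / 2)) ^ 2 = (S.q : ℝ) ^ j := by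
  rw [← Real.rpow_natCast, ← Real.rpow_mul S.q_pos_real.le, ← Real.rpow_intCast]
  congr 1
  push_cast; ring

lemma q_zpow_ennreal (j : ℤ) : (S.q : ℝ≥0∞) ^ j = ENNReal.ofReal ((S.q : ℝ) ^ j) := by
  have h := ENNReal.coe_zpow (r := (S.q : NNReal)) (by exact_mod_cast S.q_pos.ne') j
  rw [ENNReal.coe_natCast] at h
  rw [← h, ← ENNReal.ofReal_coe_nnreal]
  simp

lemma enorm_rpow_half_sq (j : ℤ) :
    ‖(((S.q : ℝ) ^ ((j : ℝ) / 2) : ℝ) : ℂ)‖ₑ ^ 2 = (S.q : ℝ≥0∞) ^ j := by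
  rw [q_zpow_ennreal, ← S.sq_rpow_half, ENNReal.ofReal_pow (by positivity), ← ofReal_norm,
    Complex.norm_real, Real.norm_of_nonneg (by positivity)]

lemma ip_dilation (j : ℤ) (f g : L2 K) : ip (S.dilation j f) (S.dilation j g) = ip f g := by
  have hemb : MeasurableEmbedding fun x : K => (S.ϖ : K) ^ (-j) * x :=
    (Homeomorph.mulLeft₀ _ (zpow_ne_zero (-j) S.ϖ_ne_zero)).measurableEmbedding
  rw [ip_eq_integral, ip_eq_integral]
  have h1 := hemb.integral_map (μ := haar K) (fun x => f x * (starRingEnd ℂ) (g x))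
  rw [map_mul_haar, integral_smul_measure, q_zpow_ennreal,
    ENNReal.toReal_ofReal (zpow_pos S.q_pos_real _).le] at h1
  have h2 : ∫ x, S.dilation j f x * (starRingEnd ℂ) (S.dilation j g x) ∂haar K =
      ∫ x, ((S.q : ℝ) ^ j : ℝ) • (f ((S.ϖ : K) ^ (-j) * x) *
        (starRingEnd ℂ) (g ((S.ϖ : K) ^ (-j) * x))) ∂haar K := by
    refine integral_congr_ae ?_
    filter_upwards [S.dilation_ae j f, S.dilation_ae j g] with x h1 h2
    rw [h1, h2, ← S.sq_rpow_half, map_mul, Complex.conj_ofReal, Complex.real_smul]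
    push_cast; ring
  rw [h2, integral_smul, ← h1, smul_smul, ← zpow_add₀ S.q_pos_real.ne', add_neg_cancel, zpow_zero,
    one_smul]

lemma energy_dilation (j : ℤ) (f : L2 K) {E : Set K} (hE : MeasurableSet E) :
    energy (S.dilation j f) E = energy f ((fun x => (S.ϖ : K) ^ j * x) ⁻¹' E) := by
  have hemb : MeasurableEmbedding fun x : K => (S.ϖ : K) ^ (-j) * x :=
    (Homeomorph.mulLeft₀ _ (zpow_ne_zero (-j) S.ϖ_ne_zero)).measurableEmbedding
  have hm : MeasurableSet ((fun x => (S.ϖ : K) ^ j * x) ⁻¹' E) := (measurable_const_mul _) hE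
  have hq0 : (S.q : ℝ≥0∞) ≠ 0 := by exact_mod_cast S.q_pos.ne'
  have hqt : (S.q : ℝ≥0∞) ≠ ∞ := ENNReal.natCast_ne_top _
  rw [energy_apply _ hE, energy_apply _ hm, ← lintegral_indicator hE, ← lintegral_indicator hm]
  have h1 := hemb.lintegral_map (μ := haar K)
    (((fun x => (S.ϖ : K) ^ j * x) ⁻¹' E).indicator fun x => ‖f x‖ₑ ^ 2)
  rw [map_mul_haar, lintegral_smul_measure] at h1
  have h2 : ∫⁻ x, E.indicator (fun x => ‖S.dilation j f x‖ₑ ^ 2) x ∂haar K =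
      ∫⁻ x, (S.q : ℝ≥0∞) ^ j * ((fun x => (S.ϖ : K) ^ j * x) ⁻¹' E).indicator
        (fun x => ‖f x‖ₑ ^ 2) ((S.ϖ : K) ^ (-j) * x) ∂haar K := by
    refine lintegral_congr_ae ?_
    filter_upwards [S.dilation_ae j f] with x h1
    have : (S.ϖ : K) ^ j * ((S.ϖ : K) ^ (-j) * x) = x := by
      rw [← mul_assoc, ← zpow_add₀ S.ϖ_ne_zero]; simp
    by_cases h : x ∈ E
    · rw [Set.indicator_of_mem h, Set.indicator_of_mem (by rwa [Set.mem_preimage, this]), h1, enorm_mul,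
        mul_pow, enorm_rpow_half_sq]
    · rw [Set.indicator_of_notMem h, Set.indicator_of_notMem (by rwa [Set.mem_preimage, this]), mul_zero]
  rw [h2, lintegral_const_mul' _ _ (by rw [q_zpow_ennreal]; exact ENNReal.ofReal_ne_top), ← h1,
    smul_eq_mul, ← mul_assoc, ← ENNReal.zpow_add hq0 hqt, add_neg_cancel, zpow_zero, one_mul]

end LatticeData

/-! ### Sums over the translation set, split by residue classes. -/

section ResidueClasses

lemma sum_range_mul_digits {M : Type*} [AddCommMonoid M] (F : ℕ → M) (m n : ℕ) :
    ∑ b ∈ Finset.range (m * n), F b =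
      ∑ i ∈ Finset.range n, ∑ b ∈ Finset.range m, F (m * i + b) := by
  induction n with
  | zero => simp
  | succ n ih => rw [Nat.mul_succ, Finset.sum_range_add, ih, Finset.sum_range_succ]

lemma ennreal_tsum_digits (F : ℕ → ℝ≥0∞) {m : ℕ} (hm : 0 < m) :
    ∑' k, F k = ∑ b ∈ Finset.range m, ∑' n, F (m * n + b) := by
  have : NeZero m := ⟨hm.ne'⟩
  rw [← (Nat.divModEquiv m).symm.tsum_eq F, ENNReal.tsum_prod', ENNReal.tsum_comm, tsum_fintype,
    ← Fin.sum_univ_eq_sum_range (fun b => ∑' n, F (m * n + b))]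
  simp [Nat.divModEquiv, mul_comm]

lemma complex_tsum_digits {F : ℕ → ℂ} (hF : Summable F) {m : ℕ} (hm : 0 < m) :
    ∑' k, F k = ∑ b ∈ Finset.range m, ∑' n, F (m * n + b) := by
  have : NeZero m := ⟨hm.ne'⟩
  have h := (Nat.divModEquiv m).symm.summable_iff.2 hF
  rw [← (Nat.divModEquiv m).symm.tsum_eq F]
  rw [show (∑' c, F ((Nat.divModEquiv m).symm c)) =
    ∑' c : ℕ × Fin m, (F ∘ (Nat.divModEquiv m).symm) c from rfl, h.tsum_prod]
  refine (Summable.tsum_comm (f := fun n b => F ((Nat.divModEquiv m).symm (n, b))) h).symm.trans ?_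
  rw [tsum_fintype,
    ← Fin.sum_univ_eq_sum_range (fun b => ∑' n, F (m * n + b))]
  simp [Nat.divModEquiv, mul_comm]

end ResidueClasses

namespace LatticeData

section Averages

variable {K : Type*} [Field K] [ValuativeRel K] [TopologicalSpace K] [IsNonarchimedeanLocalField K]
  {p : ℕ} (S : LatticeData K p) [hp : Fact p.Prime] [CharP K p]

/-- Since `u (q^s i + b) = ϖ^{-s} u i + u b`, each of the `q ^ d` blocks of length `q ^ s` has the
same sum. -/
lemma sum_range_of_periodic {M : Type*} [AddCommMonoid M] (P : K → M) (s d : ℕ)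
    (hP : ∀ y n, P (y + (S.ϖ : K) ^ (-(s : ℤ)) * S.u n) = P y) :
    ∑ b ∈ Finset.range (S.q ^ (s + d)), P (S.u b) =
      S.q ^ d • ∑ b ∈ Finset.range (S.q ^ s), P (S.u b) := by
  rw [pow_add, sum_range_mul_digits]
  have : ∀ i ∈ Finset.range (S.q ^ d), ∑ b ∈ Finset.range (S.q ^ s), P (S.u (S.q ^ s * i + b)) =
      ∑ b ∈ Finset.range (S.q ^ s), P (S.u b) := fun i _ =>
    Finset.sum_congr rfl fun b hb => by
      rw [S.u_pow_mul_add s i b (Finset.mem_range.1 hb), add_comm, hP]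
  rw [Finset.sum_congr rfl this, Finset.sum_const, Finset.card_range]

lemma tsum_periodic {M : Type*} [AddCommMonoid M] [TopologicalSpace M] (G : K → M) (j : ℤ)
    (y : K) (m : ℕ) :
    ∑' n, G ((S.ϖ : K) ^ j * S.u n + (y + (S.ϖ : K) ^ j * S.u m)) =
      ∑' n, G ((S.ϖ : K) ^ j * S.u n + y) := by
  rw [← S.tsum_u_add (fun x => G ((S.ϖ : K) ^ j * x + y)) m]
  refine tsum_congr fun n => congrArg G ?_
  ring

lemma tsum_add_u_of_nonneg {M : Type*} [AddCommMonoid M] [TopologicalSpace M] (G : K → M) {j : ℤ}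
    (hj : 0 ≤ j) (b : ℕ) :
    ∑' n, G ((S.ϖ : K) ^ j * S.u n + S.u b) = ∑' n, G ((S.ϖ : K) ^ j * S.u n) := by
  obtain ⟨s, rfl⟩ := Int.eq_ofNat_of_zero_le hj
  -- For `s ≥ 0` the group of the `ϖ^s u n` contains every `u b`, because `u b = ϖ^s u (q^s b)`.
  have h := S.tsum_periodic G s 0 (S.q ^ s * b)
  rw [u_pow_mul, ← mul_assoc, ← zpow_add₀ S.ϖ_ne_zero, add_neg_cancel, zpow_zero, one_mul,
    zero_add] at h
  rw [h]
  simp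

lemma sum_tsum_neg {M : Type*} [AddCommMonoid M] [TopologicalSpace M] (G : K → M) (s d : ℕ) :
    ∑ b ∈ Finset.range (S.q ^ (s + d)), ∑' n, G ((S.ϖ : K) ^ (-(s : ℤ)) * S.u n + S.u b) =
      S.q ^ d • ∑ b ∈ Finset.range (S.q ^ s),
        ∑' n, G ((S.ϖ : K) ^ (-(s : ℤ)) * S.u n + S.u b) :=
  S.sum_range_of_periodic (fun y => ∑' n, G ((S.ϖ : K) ^ (-(s : ℤ)) * S.u n + y)) s d
    fun y n => S.tsum_periodic G _ y n

lemma ennreal_tsum_u (G : K → ℝ≥0∞) (s : ℕ) :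
    ∑' k, G (S.u k) = ∑ b ∈ Finset.range (S.q ^ s),
      ∑' n, G ((S.ϖ : K) ^ (-(s : ℤ)) * S.u n + S.u b) := by
  rw [ennreal_tsum_digits (fun k => G (S.u k)) (pow_pos S.q_pos s)]
  exact Finset.sum_congr rfl fun b hb => tsum_congr fun n => by
    rw [S.u_pow_mul_add s n b (Finset.mem_range.1 hb)]

lemma complex_tsum_u {G : K → ℂ} (hG : Summable fun k => G (S.u k)) (s : ℕ) :
    ∑' k, G (S.u k) = ∑ b ∈ Finset.range (S.q ^ s),
      ∑' n, G ((S.ϖ : K) ^ (-(s : ℤ)) * S.u n + S.u b) := by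
  rw [complex_tsum_digits hG (pow_pos S.q_pos s)]
  exact Finset.sum_congr rfl fun b hb => tsum_congr fun n => by
    rw [S.u_pow_mul_add s n b (Finset.mem_range.1 hb)]

end Averages

/-! ### Quasi-affine layers as means of affine layers. -/

section Layers

variable {K : Type*} [Field K] [ValuativeRel K] [TopologicalSpace K] [IsNonarchimedeanLocalField K]
  [MeasurableSpace K] [BorelSpace K] {p : ℕ} (S : LatticeData K p) [hp : Fact p.Prime] [CharP K p]
  {L : ℕ}

/-- The part of scale `j` of the affine analysis of `f`. -/
noncomputable def affineEnergy (Ψ : Fin L → L2 K) (f : L2 K) (j : ℤ) : ℝ≥0∞ :=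
  ∑ l, ∑' k, ‖ip f (S.affine (Ψ l) j k)‖ₑ ^ 2

/-- The part of scale `j` of the quasi-affine analysis of `f`. -/
noncomputable def quasiAffineEnergy (Ψ : Fin L → L2 K) (f : L2 K) (j : ℤ) : ℝ≥0∞ :=
  ∑ l, ∑' k, ‖ip f (S.quasiAffine (Ψ l) j k)‖ₑ ^ 2

lemma affine_eq (h : L2 K) (j : ℤ) (k : ℕ) :
    S.affine h j k = translation ((S.ϖ : K) ^ j * S.u k) (S.dilation j h) :=
  S.dilation_translation _ _ _

lemma quasiAffine_of_nonneg (h : L2 K) {j : ℤ} (hj : 0 ≤ j) (k : ℕ) :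
    S.quasiAffine h j k = S.affine h j k := if_pos hj

lemma quasiAffine_of_neg (h : L2 K) {j : ℤ} (hj : j < 0) (k : ℕ) :
    S.quasiAffine h j k = (((S.q : ℝ) ^ ((j : ℝ) / 2) : ℝ) : ℂ) •
      translation (S.u k) (S.dilation j h) := if_neg (not_le.2 hj)

lemma ip_translation_neg_affine (f h : L2 K) (y : K) (j : ℤ) (k : ℕ) :
    ip (translation (-y) f) (S.affine h j k) =
      ip f (translation ((S.ϖ : K) ^ j * S.u k + y) (S.dilation j h)) := by
  rw [affine_eq, ip_translation_left, sub_neg_eq_add]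

lemma ip_affine_translation_neg (f h : L2 K) (y : K) (j : ℤ) (k : ℕ) :
    ip (S.affine h j k) (translation (-y) f) =
      ip (translation ((S.ϖ : K) ^ j * S.u k + y) (S.dilation j h)) f := by
  rw [affine_eq, ip_translation_right, sub_neg_eq_add]

lemma q_ne_zero_ennreal : (S.q : ℝ≥0∞) ≠ 0 := by exact_mod_cast S.q_pos.ne'

/-- For `j ≥ 0` all terms of the mean coincide. For `j = -s`, the translates by `u b` with `b < q ^
s` split the translation set into cosets of `ϖ^{-s} u(ℕ)`. Averaging over `q ^ N = q ^ (s + d)`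
translates counts each coset `q ^ d` times and leaves the factor `q^{-s} = q^j`, the square of the
normalization `q^{j/2}`. -/
lemma quasiAffineEnergy_eq (Ψ : Fin L → L2 K) (f : L2 K) (j : ℤ) (N : ℕ) (h : -(N : ℤ) ≤ j) :
    quasiAffineEnergy S Ψ f j = ((S.q : ℝ≥0∞) ^ N)⁻¹ *
      ∑ b ∈ Finset.range (S.q ^ N), S.affineEnergy Ψ (translation (-S.u b) f) j := by
  have hq : (S.q : ℝ≥0∞) ^ N ≠ 0 := pow_ne_zero _ S.q_ne_zero_ennreal
  have hqt : (S.q : ℝ≥0∞) ^ N ≠ ∞ := ENNReal.pow_ne_top (ENNReal.natCast_ne_top _)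
  unfold quasiAffineEnergy affineEnergy
  rw [Finset.sum_comm, Finset.mul_sum]
  refine Finset.sum_congr rfl fun l _ => ?_
  set G : K → ℝ≥0∞ := fun y => ‖ip f (translation y (S.dilation j (Ψ l)))‖ₑ ^ 2 with hG
  have e : ∀ b, ∑' k, ‖ip (translation (-S.u b) f) (S.affine (Ψ l) j k)‖ₑ ^ 2 =
      ∑' k, G ((S.ϖ : K) ^ j * S.u k + S.u b) := fun b =>
    tsum_congr fun k => by rw [ip_translation_neg_affine]
  simp_rw [e]
  rcases le_or_gt 0 j with hj | hj
  · simp_rw [S.tsum_add_u_of_nonneg G hj, quasiAffine_of_nonneg S _ hj, affine_eq]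
    rw [Finset.sum_const, Finset.card_range, nsmul_eq_mul, Nat.cast_pow, ← mul_assoc,
      ENNReal.inv_mul_cancel hq hqt, one_mul]
  · obtain ⟨s, rfl⟩ : ∃ s : ℕ, j = -(s : ℤ) := ⟨(-j).toNat, by omega⟩
    obtain ⟨d, rfl⟩ := Nat.exists_eq_add_of_le (show s ≤ N by omega)
    rw [sum_tsum_neg, ← ennreal_tsum_u, nsmul_eq_mul, ← mul_assoc]
    simp_rw [quasiAffine_of_neg S _ hj, ip_smul_right, enorm_mul, mul_pow]
    rw [ENNReal.tsum_mul_left]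
    congr 1
    have hqd : (S.q : ℝ≥0∞) ^ d ≠ 0 := pow_ne_zero _ S.q_ne_zero_ennreal
    have hqdt : (S.q : ℝ≥0∞) ^ d ≠ ∞ := ENNReal.pow_ne_top (ENNReal.natCast_ne_top _)
    rw [RCLike.enorm_conj, enorm_rpow_half_sq, pow_add, Nat.cast_pow,
      ENNReal.mul_inv (Or.inr hqdt) (Or.inr hqd), mul_assoc, ENNReal.inv_mul_cancel hqd hqdt,
      mul_one, ENNReal.zpow_neg, zpow_natCast]

/-- The affine part of scale `j` of the form `K_{Ψ,Φ}`. -/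
noncomputable def affineLayer (Ψ Φ : Fin L → L2 K) (f g : L2 K) (j : ℤ) : ℂ :=
  ∑ l, ∑' k, S.affineTerm Ψ Φ f g l j k

/-- The quasi-affine part of scale `j` of the form `K̃_{Ψ,Φ}`. -/
noncomputable def quasiAffineLayer (Ψ Φ : Fin L → L2 K) (f g : L2 K) (j : ℤ) : ℂ :=
  ∑ l, ∑' k, S.quasiAffineTerm Ψ Φ f g l j k

/-- Same argument as for the energies; summability now justifies regrouping the complex series by
residue classes. -/
lemma quasiAffineLayer_eq (Ψ Φ : Fin L → L2 K) (f g : L2 K) (j : ℤ) (N : ℕ) (h : -(N : ℤ) ≤ j)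
    (hs : ∀ l, Summable fun k => S.quasiAffineTerm Ψ Φ f g l j k) :
    S.quasiAffineLayer Ψ Φ f g j = ((S.q : ℂ) ^ N)⁻¹ *
      ∑ b ∈ Finset.range (S.q ^ N),
        S.affineLayer Ψ Φ (translation (-S.u b) f) (translation (-S.u b) g) j := by
  have hq0 : (S.q : ℂ) ≠ 0 := by exact_mod_cast S.q_pos.ne'
  unfold quasiAffineLayer affineLayer
  rw [Finset.sum_comm, Finset.mul_sum]
  refine Finset.sum_congr rfl fun l _ => ?_
  set G : K → ℂ := fun y => ip f (translation y (S.dilation j (Ψ l))) *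
    ip (translation y (S.dilation j (Φ l))) g with hG
  have e : ∀ b, ∑' k, S.affineTerm Ψ Φ (translation (-S.u b) f) (translation (-S.u b) g) l j k =
      ∑' k, G ((S.ϖ : K) ^ j * S.u k + S.u b) := fun b =>
    tsum_congr fun k => by
      rw [affineTerm, ip_translation_neg_affine, ip_affine_translation_neg]
  simp_rw [e]
  rcases le_or_gt 0 j with hj | hj
  · simp_rw [S.tsum_add_u_of_nonneg G hj, quasiAffineTerm, quasiAffine_of_nonneg S _ hj, affine_eq]
    rw [Finset.sum_const, Finset.card_range, nsmul_eq_mul, Nat.cast_pow, ← mul_assoc,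
      inv_mul_cancel₀ (pow_ne_zero _ hq0), one_mul]
  · have hterm : ∀ k, S.quasiAffineTerm Ψ Φ f g l j k = (S.q : ℂ) ^ j * G (S.u k) := by
      intro k
      have := S.sq_rpow_half j
      rw [quasiAffineTerm, quasiAffine_of_neg S _ hj, quasiAffine_of_neg S _ hj, ip_smul_right,
        ip_smul_left, Complex.conj_ofReal]
      have h2 : ((S.q : ℂ)) ^ j = (((S.q : ℝ) ^ ((j : ℝ) / 2) : ℝ) : ℂ) ^ 2 := by
        rw [← Complex.ofReal_pow, this]; simp
      rw [h2, hG]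
      ring
    have hGs : Summable fun k => G (S.u k) := by
      have h1 := hs l
      simp_rw [hterm] at h1
      exact (summable_mul_left_iff (zpow_ne_zero _ hq0)).1 h1
    obtain ⟨s, rfl⟩ : ∃ s : ℕ, j = -(s : ℤ) := ⟨(-j).toNat, by omega⟩
    obtain ⟨d, rfl⟩ := Nat.exists_eq_add_of_le (show s ≤ N by omega)
    rw [sum_tsum_neg, ← S.complex_tsum_u hGs, nsmul_eq_mul, ← mul_assoc]
    simp_rw [hterm]
    rw [tsum_mul_left]
    congr 1
    rw [pow_add, zpow_neg, zpow_natCast]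
    push_cast
    field_simp

end Layers

end LatticeData

/-! ### Bessel bounds and the averaged tail of low scales. -/

namespace LatticeData

variable {K : Type*} [Field K] [ValuativeRel K] [TopologicalSpace K] [IsNonarchimedeanLocalField K]
  [MeasurableSpace K] [BorelSpace K] {p : ℕ} (S : LatticeData K p) [hp : Fact p.Prime] [CharP K p]
  {L : ℕ}

lemma tsum_affineEnergy (Ψ : Fin L → L2 K) (f : L2 K) :
    ∑' j, S.affineEnergy Ψ f j =
      ∑' i : Fin L × ℤ × ℕ, ‖ip f (S.affine (Ψ i.1) i.2.1 i.2.2)‖ₑ ^ 2 := by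
  rw [ENNReal.tsum_prod', tsum_fintype (β := Fin L)]
  simp_rw [ENNReal.tsum_prod', affineEnergy]
  exact Summable.tsum_finsetSum fun _ _ => ENNReal.summable

lemma tsum_quasiAffineEnergy (Ψ : Fin L → L2 K) (f : L2 K) :
    ∑' j, S.quasiAffineEnergy Ψ f j =
      ∑' i : Fin L × ℤ × ℕ, ‖ip f (S.quasiAffine (Ψ i.1) i.2.1 i.2.2)‖ₑ ^ 2 := by
  rw [ENNReal.tsum_prod', tsum_fintype (β := Fin L)]
  simp_rw [ENNReal.tsum_prod', quasiAffineEnergy]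
  exact Summable.tsum_finsetSum fun _ _ => ENNReal.summable

lemma IsAffineBessel.exists_bound {Ψ : Fin L → L2 K} (h : S.IsAffineBessel Ψ) :
    ∃ B : ℝ≥0∞, B ≠ ∞ ∧ ∀ f : L2 K, ∑' j, S.affineEnergy Ψ f j ≤ B * ‖f‖ₑ ^ 2 := by
  obtain ⟨B, hB, h⟩ := h
  refine ⟨ENNReal.ofReal B, ENNReal.ofReal_ne_top, fun f => ?_⟩
  obtain ⟨h1, h2⟩ := h f
  rw [tsum_affineEnergy]
  have h3 := ENNReal.ofReal_le_ofReal h2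
  rw [ENNReal.ofReal_tsum_of_nonneg (fun _ => by positivity) h1, ENNReal.ofReal_mul hB.le] at h3
  simpa only [ENNReal.ofReal_pow (norm_nonneg _), ofReal_norm] using h3

/-- Translation by `u t` only permutes the group of the first `q ^ N` points. -/
lemma sum_translation_neg_add {M : Type*} [AddCommMonoid M] (H : L2 K → L2 K → M) (f g : L2 K)
    {t N : ℕ} (ht : t < S.q ^ N) :
    ∑ b ∈ Finset.range (S.q ^ N), H (translation (-S.u b) (translation (S.u t) f))
      (translation (-S.u b) (translation (S.u t) g)) =
      ∑ b ∈ Finset.range (S.q ^ N), H (translation (-S.u b) f) (translation (-S.u b) g) := by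
  rw [← S.sum_u_add (fun x => H (translation (-x) (translation (S.u t) f))
    (translation (-x) (translation (S.u t) g))) ht]
  refine Finset.sum_congr rfl fun b _ => ?_
  rw [translation_translation, translation_translation, neg_add, neg_add_cancel_right]

lemma card_inv_mul_sum_le (F : ℕ → ℝ≥0∞) (C : ℝ≥0∞) (N : ℕ) (h : ∀ b, F b ≤ C) :
    ((S.q : ℝ≥0∞) ^ N)⁻¹ * ∑ b ∈ Finset.range (S.q ^ N), F b ≤ C := by
  have hq : (S.q : ℝ≥0∞) ^ N ≠ 0 := pow_ne_zero _ S.q_ne_zero_ennreal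
  have hqt : (S.q : ℝ≥0∞) ^ N ≠ ∞ := ENNReal.pow_ne_top (ENNReal.natCast_ne_top _)
  calc _ ≤ ((S.q : ℝ≥0∞) ^ N)⁻¹ * ∑ b ∈ Finset.range (S.q ^ N), C := by gcongr; exact h _
    _ = C := by
      rw [Finset.sum_const, Finset.card_range, nsmul_eq_mul, Nat.cast_pow, ← mul_assoc,
        ENNReal.inv_mul_cancel hq hqt, one_mul]

/-- Finitely many scales lie above a common `-N`, so their quasi-affine energy is a mean of affine
energies of translates. Translations are isometries, so the constant `B` survives. -/
lemma tsum_quasiAffineEnergy_le {Ψ : Fin L → L2 K} {B : ℝ≥0∞}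
    (hB : ∀ f : L2 K, ∑' j, S.affineEnergy Ψ f j ≤ B * ‖f‖ₑ ^ 2) (f : L2 K) :
    ∑' j, S.quasiAffineEnergy Ψ f j ≤ B * ‖f‖ₑ ^ 2 := by
  rw [ENNReal.tsum_eq_iSup_sum]
  refine iSup_le fun s => ?_
  obtain ⟨N, hN⟩ : ∃ N : ℕ, ∀ j ∈ s, -(N : ℤ) ≤ j := by
    refine ⟨∑ j ∈ s, j.natAbs, fun j hj => ?_⟩
    have := Finset.single_le_sum (f := fun j : ℤ => j.natAbs) (fun _ _ => Nat.zero_le _) hj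
    omega
  rw [Finset.sum_congr rfl fun j hj => S.quasiAffineEnergy_eq Ψ f j N (hN j hj), ← Finset.mul_sum,
    Finset.sum_comm]
  refine S.card_inv_mul_sum_le _ _ N fun b => ?_
  calc _ ≤ ∑' j, S.affineEnergy Ψ (translation (-S.u b) f) j := ENNReal.sum_le_tsum s
    _ ≤ _ := hB _
    _ = _ := by rw [enorm_translation]

/-- The mean, over the translates of `f` by the first `q ^ N` elements of the translation set, of
the affine analysis at scales below `-N`. -/
noncomputable def tailMean (Ψ : Fin L → L2 K) (N : ℕ) (f : L2 K) : ℝ≥0∞ :=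
  ((S.q : ℝ≥0∞) ^ N)⁻¹ * ∑ b ∈ Finset.range (S.q ^ N),
    ∑' i : ℕ, S.affineEnergy Ψ (translation (-S.u b) f) (-((N + 1 + i : ℕ) : ℤ))

lemma tsum_tail_le (a : ℤ → ℝ≥0∞) (N : ℕ) :
    ∑' i : ℕ, a (-((N + 1 + i : ℕ) : ℤ)) ≤ ∑' j, a j :=
  ENNReal.tsum_comp_le_tsum_of_injective (f := fun i : ℕ => -((N + 1 + i : ℕ) : ℤ))
    (fun i j h => by simpa using h) a

lemma tailMean_le {Ψ : Fin L → L2 K} {B : ℝ≥0∞}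
    (hB : ∀ f : L2 K, ∑' j, S.affineEnergy Ψ f j ≤ B * ‖f‖ₑ ^ 2) (N : ℕ) (f : L2 K) :
    S.tailMean Ψ N f ≤ B * ‖f‖ₑ ^ 2 := by
  refine S.card_inv_mul_sum_le _ _ N fun b => (tsum_tail_le _ N).trans ((hB _).trans_eq ?_)
  rw [enorm_translation]

lemma affineEnergy_add_le (Ψ : Fin L → L2 K) (f g : L2 K) (j : ℤ) :
    S.affineEnergy Ψ (f + g) j ≤ 2 * S.affineEnergy Ψ f j + 2 * S.affineEnergy Ψ g j := by
  unfold affineEnergy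
  rw [Finset.mul_sum, Finset.mul_sum, ← Finset.sum_add_distrib]
  refine Finset.sum_le_sum fun l _ => ?_
  rw [← ENNReal.tsum_mul_left, ← ENNReal.tsum_mul_left, ← ENNReal.tsum_add]
  refine ENNReal.tsum_le_tsum fun k => ?_
  rw [ip_add_left, ← mul_add]
  have h : ∀ x y : ℂ, ‖x + y‖ₑ ^ 2 ≤ 2 * (‖x‖ₑ ^ 2 + ‖y‖ₑ ^ 2) := fun x y => by
    have h1 : ‖x + y‖₊ ^ 2 ≤ 2 * (‖x‖₊ ^ 2 + ‖y‖₊ ^ 2) :=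
      (pow_le_pow_left' (nnnorm_add_le x y) 2).trans add_sq_le
    simp only [enorm_eq_nnnorm]
    exact_mod_cast h1
  exact h _ _

lemma tailMean_add_le (Ψ : Fin L → L2 K) (N : ℕ) (f g : L2 K) :
    S.tailMean Ψ N (f + g) ≤ 2 * S.tailMean Ψ N f + 2 * S.tailMean Ψ N g := by
  unfold tailMean
  rw [mul_left_comm, mul_left_comm 2, ← mul_add, Finset.mul_sum (a := (2 : ℝ≥0∞)),
    Finset.mul_sum (a := (2 : ℝ≥0∞)), ← Finset.sum_add_distrib]
  gcongr with b _
  rw [← ENNReal.tsum_mul_left, ← ENNReal.tsum_mul_left, ← ENNReal.tsum_add]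
  refine ENNReal.tsum_le_tsum fun i => ?_
  rw [translation_add]
  exact S.affineEnergy_add_le Ψ _ _ _

/-- The sum of the energies of the translates of `f` over `𝔇` is at most `‖f‖²`. -/
lemma tsum_energy_translation_integer_le (f : L2 K) :
    ∑' k, energy (translation (S.u k) f) (𝒪[K] : Set K) ≤ ‖f‖ₑ ^ 2 := by
  have h : ∀ k, energy (translation (S.u k) f) (𝒪[K] : Set K) = energy f (coset (-S.u k)) :=
    fun k => by
      rw [energy_translation _ _ measurableSet_integer, coset]
      simp_rw [sub_neg_eq_add]
  simp_rw [h]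
  rw [← energy_univ]
  exact (tsum_meas_le_meas_iUnion_of_disjoint _ (fun k => measurableSet_coset _)
    fun a b hab => S.disjoint_coset_neg hab).trans (measure_mono (Set.subset_univ _))

lemma biUnion_coset_neg_subset (N : ℕ) :
    ⋃ b ∈ (Finset.range (S.q ^ N)).erase 0, coset (-S.u b) ⊆ S.ball N \ S.ball 0 := by
  refine Set.iUnion₂_subset fun b hb x hx => ?_
  rw [Finset.mem_erase, Finset.mem_range] at hb
  refine ⟨?_, fun h0 => ?_⟩
  · have h1 : (S.ϖ : K) ^ N * (x - -S.u b) ∈ 𝒪[K] := mul_mem (pow_mem S.ϖ.2 _) hx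
    have := sub_mem h1 (S.pow_mul_u_mem hb.2)
    rw [← mul_sub, sub_neg_eq_add, add_sub_cancel_right] at this
    simpa [ball] using this
  · rw [ball_zero] at h0
    refine Set.disjoint_left.1 (S.disjoint_coset_neg hb.1) hx ?_
    simpa [coset] using h0

/-- The two exponents simplify to `-(i + 1)` and `-(i + N + 1)`, so the difference decomposes into
`N` consecutive shells. The unsimplified form is the one produced by `mul_preimage_ball`. -/
lemma ball_sdiff_subset (N i : ℕ) : S.ball (N + -((N + 1 + i : ℕ) : ℤ)) \
    S.ball (0 + -((N + 1 + i : ℕ) : ℤ)) ⊆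
      ⋃ r ∈ Finset.range N, S.ball (-((i + r + 1 : ℕ) : ℤ)) \ S.ball (-((i + r + 2 : ℕ) : ℤ)) := by
  rintro x ⟨h1, h2⟩
  have h1' : x ∈ S.ball (-((i + 0 + 1 : ℕ) : ℤ)) := by
    convert h1 using 2; push_cast; ring
  have h2' : x ∉ S.ball (-((i + N + 1 : ℕ) : ℤ)) := by
    convert h2 using 3; push_cast; ring
  clear h1 h2
  induction N with
  | zero => exact absurd h1' h2'
  | succ N ih =>
    by_cases h : x ∈ S.ball (-((i + N + 1 : ℕ) : ℤ))
    · exact Set.mem_biUnion (Finset.mem_coe.2 (Finset.self_mem_range_succ N))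
        ⟨h, by convert h2' using 3; push_cast; ring⟩
    · obtain ⟨r, hr, hx⟩ := Set.mem_iUnion₂.1 (ih h)
      exact Set.mem_biUnion (Finset.mem_coe.2 (Finset.mem_range.2
        ((Finset.mem_range.1 hr).trans N.lt_succ_self))) hx

/-- The annuli at distance `N` swept by the dilated punctured ball `ϖ^{-N} 𝔇 \ 𝔇` cover `𝔇` at
most `N` times. -/
lemma tsum_energy_annuli_le (f : L2 K) (N : ℕ) :
    ∑' i : ℕ, energy f (S.ball (N + -((N + 1 + i : ℕ) : ℤ)) \
      S.ball (0 + -((N + 1 + i : ℕ) : ℤ))) ≤ N * energy f (𝒪[K] : Set K) := by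
  have hm : ∀ t : ℕ, MeasurableSet
      (S.ball (-((t + 1 : ℕ) : ℤ)) \ S.ball (-((t + 2 : ℕ) : ℤ))) := fun t =>
    (S.measurableSet_ball _).diff (S.measurableSet_ball _)
  have hr : ∀ r : ℕ, ∑' i : ℕ, energy f
      (S.ball (-((i + r + 1 : ℕ) : ℤ)) \ S.ball (-((i + r + 2 : ℕ) : ℤ))) ≤
      energy f (𝒪[K] : Set K) := by
    intro r
    refine (tsum_meas_le_meas_iUnion_of_disjoint _ (fun i => hm (i + r)) ?_).trans
      (measure_mono (Set.iUnion_subset fun i x hx => ?_))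
    · have key : ∀ a b : ℕ, a < b → Disjoint
          (S.ball (-((a + r + 1 : ℕ) : ℤ)) \ S.ball (-((a + r + 2 : ℕ) : ℤ)))
          (S.ball (-((b + r + 1 : ℕ) : ℤ)) \ S.ball (-((b + r + 2 : ℕ) : ℤ))) := fun a b hab =>
        Set.disjoint_left.2 fun x ha hb => ha.2 (S.ball_mono (by push_cast; omega) hb.1)
      intro a b hab
      rcases lt_or_gt_of_ne hab with h | h
      · exact key a b h
      · exact (key b a h).symm
    · rw [← S.ball_zero]
      exact S.ball_mono (by omega) hx.1
  calc _ ≤ ∑' i : ℕ, ∑ r ∈ Finset.range N, energy f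
        (S.ball (-((i + r + 1 : ℕ) : ℤ)) \ S.ball (-((i + r + 2 : ℕ) : ℤ))) :=
        ENNReal.tsum_le_tsum fun i => (measure_mono (S.ball_sdiff_subset N i)).trans
          (measure_biUnion_finset_le _ _)
    _ = ∑ r ∈ Finset.range N, ∑' i : ℕ, energy f
        (S.ball (-((i + r + 1 : ℕ) : ℤ)) \ S.ball (-((i + r + 2 : ℕ) : ℤ))) :=
        Summable.tsum_finsetSum fun _ _ => ENNReal.summable
    _ ≤ ∑ r ∈ Finset.range N, energy f (𝒪[K] : Set K) := Finset.sum_le_sum fun r _ => hr r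
    _ = _ := by rw [Finset.sum_const, Finset.card_range, nsmul_eq_mul]

/-- The translates of `f` have disjoint supports, so the local Cauchy–Schwarz bounds add up to one
energy, and the dilation moves onto the set. The index `b = 0` is left out because it would
contribute the nested balls `S.ball j`, whose overlaps as `j → -∞` are unbounded. -/
lemma sum_enorm_ip_affine_le {f : L2 K} (hf : SupportedOn f (𝒪[K] : Set K)) (h : L2 K) (j : ℤ)
    (k N : ℕ) :
    ∑ b ∈ (Finset.range (S.q ^ N)).erase 0, ‖ip (translation (-S.u b) f) (S.affine h j k)‖ₑ ^ 2 ≤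
      ‖f‖ₑ ^ 2 * energy (translation (S.u k) h) (S.ball (N + j) \ S.ball (0 + j)) := by
  calc _ ≤ ∑ b ∈ (Finset.range (S.q ^ N)).erase 0,
        ‖f‖ₑ ^ 2 * energy (S.affine h j k) (coset (-S.u b)) :=
        Finset.sum_le_sum fun b _ => by
          have := (hf.translation (-S.u b)).enorm_ip_sq_le (measurableSet_coset _) (S.affine h j k)
          rwa [enorm_translation] at this
    _ = ‖f‖ₑ ^ 2 * energy (S.affine h j k)
        (⋃ b ∈ (Finset.range (S.q ^ N)).erase 0, coset (-S.u b)) := by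
        rw [← Finset.mul_sum, measure_biUnion_finset (fun a _ b _ hab => S.disjoint_coset_neg hab)
          fun b _ => measurableSet_coset _]
    _ ≤ ‖f‖ₑ ^ 2 * energy (S.affine h j k) (S.ball N \ S.ball 0) := by
        gcongr
        exact S.biUnion_coset_neg_subset N
    _ = _ := by
        rw [affine, energy_dilation _ _ _ ((S.measurableSet_ball _).diff (S.measurableSet_ball _)),
          Set.preimage_sdiff, mul_preimage_ball, mul_preimage_ball]

/-- The term `b = 0` is bounded by the Bessel constant. The others cost `N` by the overlap of the
annuli, while the sum over `k` of the energies on `𝔇` is at most `‖Ψ l‖²`. -/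
lemma tailMean_le_of_supportedOn {Ψ : Fin L → L2 K} {B : ℝ≥0∞}
    (hB : ∀ f : L2 K, ∑' j, S.affineEnergy Ψ f j ≤ B * ‖f‖ₑ ^ 2) (N : ℕ) {f : L2 K}
    (hf : SupportedOn f (𝒪[K] : Set K)) :
    S.tailMean Ψ N f ≤ ((S.q : ℝ≥0∞) ^ N)⁻¹ *
      (B * ‖f‖ₑ ^ 2 + N * (‖f‖ₑ ^ 2 * ∑ l, ‖Ψ l‖ₑ ^ 2)) := by
  unfold tailMean
  gcongr
  rw [← Finset.add_sum_erase _ _ (Finset.mem_range.2 (pow_pos S.q_pos N))]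
  gcongr
  · rw [u_zero, neg_zero, translation_zero]
    exact (tsum_tail_le _ N).trans (hB f)
  · calc _ = ∑ l, ∑' k, ∑' i : ℕ, ∑ b ∈ (Finset.range (S.q ^ N)).erase 0,
          ‖ip (translation (-S.u b) f) (S.affine (Ψ l) (-((N + 1 + i : ℕ) : ℤ)) k)‖ₑ ^ 2 := by
          unfold affineEnergy
          rw [← Summable.tsum_finsetSum fun _ _ => ENNReal.summable]
          simp_rw [Finset.sum_comm (s := (Finset.range (S.q ^ N)).erase 0)]
          rw [Summable.tsum_finsetSum fun _ _ => ENNReal.summable]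
          refine Finset.sum_congr rfl fun l _ => ?_
          rw [ENNReal.tsum_comm]
          refine tsum_congr fun i => ?_
          exact (Summable.tsum_finsetSum fun _ _ => ENNReal.summable).symm
      _ ≤ ∑ l, ∑' k, ∑' i : ℕ, ‖f‖ₑ ^ 2 * energy (translation (S.u k) (Ψ l))
          (S.ball (N + -((N + 1 + i : ℕ) : ℤ)) \ S.ball (0 + -((N + 1 + i : ℕ) : ℤ))) :=
          Finset.sum_le_sum fun l _ => ENNReal.tsum_le_tsum fun k => ENNReal.tsum_le_tsum fun i =>
            S.sum_enorm_ip_affine_le hf (Ψ l) _ k N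
      _ ≤ ∑ l, ∑' k, ‖f‖ₑ ^ 2 * (N * energy (translation (S.u k) (Ψ l)) (𝒪[K] : Set K)) :=
          Finset.sum_le_sum fun l _ => ENNReal.tsum_le_tsum fun k => by
            rw [ENNReal.tsum_mul_left]
            gcongr
            exact S.tsum_energy_annuli_le _ N
      _ ≤ ∑ l, ‖f‖ₑ ^ 2 * (N * ‖Ψ l‖ₑ ^ 2) :=
          Finset.sum_le_sum fun l _ => by
            rw [ENNReal.tsum_mul_left, ENNReal.tsum_mul_left]
            gcongr
            exact S.tsum_energy_translation_integer_le _
      _ = _ := by rw [← Finset.mul_sum, ← Finset.mul_sum]; ring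

end LatticeData

/-! ### Estimates for series of products. -/

lemma summable_of_tsum_enorm_ne_top {ι : Type*} {F : ι → ℂ} (h : ∑' i, ‖F i‖ₑ ≠ ∞) :
    Summable F :=
  Summable.of_nnnorm (ENNReal.tsum_coe_ne_top_iff_summable.1 h)

lemma enorm_mul_le_sq_add_sq (x y : ℂ) : ‖x * y‖ₑ ≤ ‖x‖ₑ ^ 2 + ‖y‖ₑ ^ 2 := by
  have h : ‖x‖₊ * ‖y‖₊ ≤ ‖x‖₊ ^ 2 + ‖y‖₊ ^ 2 := by
    rw [← NNReal.coe_le_coe]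
    push_cast
    nlinarith [sq_nonneg (‖x‖ - ‖y‖), sq_nonneg ‖x‖, sq_nonneg ‖y‖]
  rw [enorm_mul]
  simp only [enorm_eq_nnnorm]
  exact_mod_cast h

lemma enorm_tsum_mul_le {ι : Type*} (F G : ι → ℂ) :
    ‖∑' i, F i * G i‖ₑ ≤ ∑' i, ‖F i‖ₑ ^ 2 + ∑' i, ‖G i‖ₑ ^ 2 := by
  rw [← ENNReal.tsum_add]
  exact enorm_tsum_le_tsum_enorm.trans (ENNReal.tsum_le_tsum fun i => enorm_mul_le_sq_add_sq _ _)

lemma summable_mul_of_tsum_sq_ne_top {ι : Type*} {F G : ι → ℂ} (hF : ∑' i, ‖F i‖ₑ ^ 2 ≠ ∞)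
    (hG : ∑' i, ‖G i‖ₑ ^ 2 ≠ ∞) : Summable fun i => F i * G i := by
  refine summable_of_tsum_enorm_ne_top (ne_top_of_le_ne_top (ENNReal.add_ne_top.2 ⟨hF, hG⟩) ?_)
  rw [← ENNReal.tsum_add]
  exact ENNReal.tsum_le_tsum fun i => enorm_mul_le_sq_add_sq _ _

lemma tendsto_inv_pow_mul_add {q : ℕ} (hq : 1 < q) {C D : ℝ≥0∞} (hC : C ≠ ∞) (hD : D ≠ ∞) :
    Filter.Tendsto (fun N : ℕ => ((q : ℝ≥0∞) ^ N)⁻¹ * (C + N * D)) Filter.atTop (nhds 0) := by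
  have hq' : (1 : ℝ) < q := by exact_mod_cast hq
  have h0 : ∀ k : ℕ, Filter.Tendsto (fun N : ℕ => ((q : ℝ≥0∞) ^ N)⁻¹ * (N : ℝ≥0∞) ^ k)
      Filter.atTop (nhds 0) := by
    intro k
    have h := ENNReal.tendsto_ofReal (tendsto_pow_const_div_const_pow_of_one_lt k hq')
    rw [ENNReal.ofReal_zero] at h
    refine h.congr fun N => ?_
    rw [ENNReal.ofReal_div_of_pos (by positivity), ENNReal.ofReal_pow (by positivity),
      ENNReal.ofReal_pow (by positivity), ENNReal.ofReal_natCast, ENNReal.ofReal_natCast,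
      div_eq_mul_inv, mul_comm]
  have h1 := (ENNReal.Tendsto.mul_const (h0 0) (Or.inr hC)).add
    (ENNReal.Tendsto.mul_const (h0 1) (Or.inr hD))
  simp only [zero_mul, add_zero] at h1
  refine h1.congr fun N => ?_
  ring

/-! ### Vanishing of the averaged tail, and absolute convergence. -/

namespace LatticeData

variable {K : Type*} [Field K] [ValuativeRel K] [TopologicalSpace K] [IsNonarchimedeanLocalField K]
  [MeasurableSpace K] [BorelSpace K] {p : ℕ} (S : LatticeData K p) [hp : Fact p.Prime] [CharP K p]
  {L : ℕ}

lemma tailMean_translation (Ψ : Fin L → L2 K) (f : L2 K) {t N : ℕ} (ht : t < S.q ^ N) :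
    S.tailMean Ψ N (translation (S.u t) f) = S.tailMean Ψ N f := by
  unfold tailMean
  rw [S.sum_translation_neg_add
    (fun h _ => ∑' i : ℕ, S.affineEnergy Ψ h (-((N + 1 + i : ℕ) : ℤ))) f f ht]

lemma tendsto_energy_compl_ball (f : L2 K) :
    Filter.Tendsto (fun n : ℕ => energy f (S.ball n)ᶜ) Filter.atTop (nhds 0) := by
  have h := tendsto_measure_iInter_atTop (μ := energy f) (s := fun n : ℕ => (S.ball n)ᶜ)
    (fun n => (S.measurableSet_ball n).compl.nullMeasurableSet)
    (fun a b hab => Set.compl_subset_compl.2 (S.ball_mono (by exact_mod_cast hab)))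
    ⟨0, measure_ne_top _ _⟩
  rwa [← Set.compl_iUnion, iUnion_ball, Set.compl_univ, measure_empty] at h

/-- The explicit bound settles functions supported on `𝔇`, hence on its cosets by invariance under
`u t`, hence on balls by finite sums. The part of `f` outside a large ball is small uniformly in `N`
by the Bessel bound. -/
lemma tendsto_tailMean {Ψ : Fin L → L2 K} (hΨ : S.IsAffineBessel Ψ) (f : L2 K) :
    Filter.Tendsto (fun N => S.tailMean Ψ N f) Filter.atTop (nhds 0) := by
  obtain ⟨B, hBt, hB⟩ := hΨ.exists_bound
  have hsq : ∀ f : L2 K, ‖f‖ₑ ^ 2 ≠ ∞ := fun f => ENNReal.pow_ne_top enorm_ne_top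
  have hint : ∀ f : L2 K, SupportedOn f (𝒪[K] : Set K) →
      Filter.Tendsto (fun N => S.tailMean Ψ N f) Filter.atTop (nhds 0) := fun f hf =>
    tendsto_of_tendsto_of_tendsto_of_le_of_le tendsto_const_nhds
      (tendsto_inv_pow_mul_add S.one_lt_q (ENNReal.mul_ne_top hBt (hsq f))
        (ENNReal.mul_ne_top (hsq f) (ENNReal.sum_ne_top.2 fun l _ => hsq (Ψ l))))
      (fun _ => zero_le) (fun N => S.tailMean_le_of_supportedOn hB N hf)
  have hcoset : ∀ (f : L2 K) (t : ℕ), SupportedOn f (coset (S.u t)) →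
      Filter.Tendsto (fun N => S.tailMean Ψ N f) Filter.atTop (nhds 0) := by
    intro f t hf
    have h1 : SupportedOn (translation (-S.u t) f) (𝒪[K] : Set K) := by
      have := hf.translation (-S.u t)
      simpa [coset, Set.preimage_preimage] using this
    -- Invariance of the mean under `u t` requires `t < q ^ N`, so equality holds only eventually.
    refine (hint _ h1).congr' ?_
    filter_upwards [Filter.eventually_ge_atTop t] with N hN
    rw [← S.tailMean_translation Ψ _ ((Nat.lt_pow_self S.one_lt_q).trans_le
      (Nat.pow_le_pow_right S.q_pos hN)), translation_translation, add_neg_cancel,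
      translation_zero]
  have hadd : ∀ f g : L2 K, Filter.Tendsto (fun N => S.tailMean Ψ N f) Filter.atTop (nhds 0) →
      Filter.Tendsto (fun N => S.tailMean Ψ N g) Filter.atTop (nhds 0) →
      Filter.Tendsto (fun N => S.tailMean Ψ N (f + g)) Filter.atTop (nhds 0) := by
    intro f g hf hg
    have h := (ENNReal.Tendsto.const_mul (a := 2) hf (Or.inr ENNReal.ofNat_ne_top)).add
      (ENNReal.Tendsto.const_mul (a := 2) hg (Or.inr ENNReal.ofNat_ne_top))
    simp only [mul_zero, add_zero] at h
    exact tendsto_of_tendsto_of_tendsto_of_le_of_le tendsto_const_nhds h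
      (fun _ => zero_le) (fun N => S.tailMean_add_le Ψ N f g)
  have hball : ∀ n : ℕ, Filter.Tendsto
      (fun N => S.tailMean Ψ N (restr (S.ball n) (S.measurableSet_ball n) f))
      Filter.atTop (nhds 0) := by
    intro n
    rw [restr_eq_sum (Finset.range (S.q ^ n)) (fun b => coset (S.u b))
      (fun b => measurableSet_coset _) (fun a _ b _ hab => S.disjoint_coset hab) _ _
      (S.ball_eq_biUnion n)]
    refine Finset.sum_induction (fun b => restr (coset (S.u b)) (measurableSet_coset _) f)
      (fun g => Filter.Tendsto (fun N => S.tailMean Ψ N g) Filter.atTop (nhds 0)) hadd ?_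
      fun b _ => hcoset _ b (supportedOn_restr _ _ _)
    refine hint 0 ?_
    filter_upwards [Lp.coeFn_zero ℂ 2 (haar K)] with x hx _
    rw [hx, Pi.zero_apply]
  rw [ENNReal.tendsto_nhds_zero]
  intro ε hε
  have hε2 : 0 < ε / 2 := ENNReal.half_pos hε.ne'
  -- The factor `2` is that of `tailMean_add_le`, and `B` that of `tailMean_le`.
  have h1 := ENNReal.Tendsto.const_mul (a := 2 * B) (S.tendsto_energy_compl_ball f)
    (Or.inr (ENNReal.mul_ne_top ENNReal.ofNat_ne_top hBt))
  rw [mul_zero] at h1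
  obtain ⟨n, hn⟩ := (ENNReal.tendsto_nhds_zero.1 h1 _ hε2).exists
  have h2 := ENNReal.Tendsto.const_mul (a := 2) (hball n) (Or.inr ENNReal.ofNat_ne_top)
  rw [mul_zero] at h2
  filter_upwards [ENNReal.tendsto_nhds_zero.1 h2 _ hε2] with N hN
  calc S.tailMean Ψ N f
      = S.tailMean Ψ N (restr (S.ball n) (S.measurableSet_ball n) f +
          restr (S.ball n)ᶜ (S.measurableSet_ball n).compl f) := by rw [restr_add_restr_compl]
    _ ≤ 2 * S.tailMean Ψ N (restr (S.ball n) (S.measurableSet_ball n) f) +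
          2 * S.tailMean Ψ N (restr (S.ball n)ᶜ (S.measurableSet_ball n).compl f) :=
        S.tailMean_add_le Ψ N _ _
    _ ≤ ε / 2 + ε / 2 := by
        gcongr
        refine le_trans ?_ hn
        rw [mul_assoc]
        gcongr
        rw [← enorm_restr_sq _ (S.measurableSet_ball n).compl]
        exact S.tailMean_le hB N _
    _ = ε := ENNReal.add_halves ε

lemma IsAffineBessel.tsum_affine_ne_top {Ψ : Fin L → L2 K} (hΨ : S.IsAffineBessel Ψ) (f : L2 K) :
    ∑' i : Fin L × ℤ × ℕ, ‖ip f (S.affine (Ψ i.1) i.2.1 i.2.2)‖ₑ ^ 2 ≠ ∞ := by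
  obtain ⟨B, hBt, hB⟩ := hΨ.exists_bound
  rw [← tsum_affineEnergy]
  exact ne_top_of_le_ne_top (ENNReal.mul_ne_top hBt (ENNReal.pow_ne_top enorm_ne_top)) (hB f)

lemma IsAffineBessel.tsum_quasiAffine_ne_top {Ψ : Fin L → L2 K} (hΨ : S.IsAffineBessel Ψ)
    (f : L2 K) :
    ∑' i : Fin L × ℤ × ℕ, ‖ip f (S.quasiAffine (Ψ i.1) i.2.1 i.2.2)‖ₑ ^ 2 ≠ ∞ := by
  obtain ⟨B, hBt, hB⟩ := hΨ.exists_bound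
  rw [← tsum_quasiAffineEnergy]
  exact ne_top_of_le_ne_top (ENNReal.mul_ne_top hBt (ENNReal.pow_ne_top enorm_ne_top))
    (S.tsum_quasiAffineEnergy_le hB f)

lemma summable_affineTerm {Ψ Φ : Fin L → L2 K} (hΨ : S.IsAffineBessel Ψ) (hΦ : S.IsAffineBessel Φ)
    (f g : L2 K) : Summable fun i : Fin L × ℤ × ℕ => S.affineTerm Ψ Φ f g i.1 i.2.1 i.2.2 := by
  refine summable_mul_of_tsum_sq_ne_top (hΨ.tsum_affine_ne_top S f) ?_
  simp_rw [fun i : Fin L × ℤ × ℕ => enorm_ip_comm (S.affine (Φ i.1) i.2.1 i.2.2) g]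
  exact hΦ.tsum_affine_ne_top S g

lemma summable_quasiAffineTerm {Ψ Φ : Fin L → L2 K} (hΨ : S.IsAffineBessel Ψ)
    (hΦ : S.IsAffineBessel Φ) (f g : L2 K) :
    Summable fun i : Fin L × ℤ × ℕ => S.quasiAffineTerm Ψ Φ f g i.1 i.2.1 i.2.2 := by
  refine summable_mul_of_tsum_sq_ne_top (hΨ.tsum_quasiAffine_ne_top S f) ?_
  simp_rw [fun i : Fin L × ℤ × ℕ => enorm_ip_comm (S.quasiAffine (Φ i.1) i.2.1 i.2.2) g]
  exact hΦ.tsum_quasiAffine_ne_top S g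

lemma hasSum_layers {T : Fin L → ℤ → ℕ → ℂ}
    (h : Summable fun i : Fin L × ℤ × ℕ => T i.1 i.2.1 i.2.2) :
    HasSum (fun j => ∑ l, ∑' k, T l j k) (∑ l, ∑' j, ∑' k, T l j k) :=
  hasSum_sum fun l _ => ((h.prod_factor l).prod (f := fun i : ℤ × ℕ => T l i.1 i.2)).hasSum

lemma hasSum_affineLayer {Ψ Φ : Fin L → L2 K} (hΨ : S.IsAffineBessel Ψ) (hΦ : S.IsAffineBessel Φ)
    (f g : L2 K) : HasSum (S.affineLayer Ψ Φ f g) (S.affineForm Ψ Φ f g) :=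
  hasSum_layers (S.summable_affineTerm hΨ hΦ f g)

lemma hasSum_quasiAffineLayer {Ψ Φ : Fin L → L2 K} (hΨ : S.IsAffineBessel Ψ)
    (hΦ : S.IsAffineBessel Φ) (f g : L2 K) :
    HasSum (S.quasiAffineLayer Ψ Φ f g) (S.quasiAffineForm Ψ Φ f g) :=
  hasSum_layers (S.summable_quasiAffineTerm hΨ hΦ f g)

lemma IsAffineBessel.quasiAffineLayer_eq {Ψ Φ : Fin L → L2 K} (hΨ : S.IsAffineBessel Ψ)
    (hΦ : S.IsAffineBessel Φ) (f g : L2 K) {j : ℤ} {N : ℕ} (h : -(N : ℤ) ≤ j) :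
    S.quasiAffineLayer Ψ Φ f g j = ((S.q : ℂ) ^ N)⁻¹ *
      ∑ b ∈ Finset.range (S.q ^ N),
        S.affineLayer Ψ Φ (translation (-S.u b) f) (translation (-S.u b) g) j :=
  S.quasiAffineLayer_eq Ψ Φ f g j N h fun l =>
    ((S.summable_quasiAffineTerm hΨ hΦ f g).prod_factor l).prod_factor j

lemma enorm_affineLayer_le (Ψ Φ : Fin L → L2 K) (f g : L2 K) (j : ℤ) :
    ‖S.affineLayer Ψ Φ f g j‖ₑ ≤ S.affineEnergy Ψ f j + S.affineEnergy Φ g j := by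
  unfold affineLayer affineEnergy affineTerm
  rw [← Finset.sum_add_distrib]
  refine enorm_sum_le_of_le _ fun l _ => ?_
  simp_rw [fun k => enorm_ip_comm g (S.affine (Φ l) j k)]
  exact enorm_tsum_mul_le _ _

/-! ### Translation invariance implies equality of the forms. -/

/-- The mean of the affine layers of the translates of `f` and `g`. -/
noncomputable def layerMean (Ψ Φ : Fin L → L2 K) (f g : L2 K) (N : ℕ) (j : ℤ) : ℂ :=
  ((S.q : ℂ) ^ N)⁻¹ * ∑ b ∈ Finset.range (S.q ^ N),
    S.affineLayer Ψ Φ (translation (-S.u b) f) (translation (-S.u b) g) j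

lemma tsum_enorm_layerMean_le (Ψ Φ : Fin L → L2 K) (f g : L2 K) (N : ℕ) :
    ∑' i : ℕ, ‖S.layerMean Ψ Φ f g N (-((N + 1 + i : ℕ) : ℤ))‖ₑ ≤
      S.tailMean Ψ N f + S.tailMean Φ N g := by
  have hq0 : (S.q : ℂ) ^ N ≠ 0 := pow_ne_zero _ (by exact_mod_cast S.q_pos.ne')
  have hnorm : ‖((S.q : ℂ) ^ N)⁻¹‖ₑ = ((S.q : ℝ≥0∞) ^ N)⁻¹ := by
    rw [enorm_inv hq0, enorm_pow, ← ofReal_norm, Complex.norm_natCast, ENNReal.ofReal_natCast]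
  unfold layerMean tailMean
  simp_rw [enorm_mul, hnorm]
  rw [ENNReal.tsum_mul_left, ← mul_add, ← Finset.sum_add_distrib]
  gcongr
  simp_rw [← ENNReal.tsum_add]
  rw [← Summable.tsum_finsetSum fun _ _ => ENNReal.summable]
  exact ENNReal.tsum_le_tsum fun i => enorm_sum_le_of_le _ fun b _ =>
    S.enorm_affineLayer_le Ψ Φ _ _ _

lemma hasSum_layerMean {Ψ Φ : Fin L → L2 K} (hΨ : S.IsAffineBessel Ψ)
    (hΦ : S.IsAffineBessel Φ) (hT : IsTranslationInvariant (S.affineForm Ψ Φ)) (f g : L2 K)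
    (N : ℕ) : HasSum (S.layerMean Ψ Φ f g N) (S.affineForm Ψ Φ f g) := by
  have hq0 : (S.q : ℂ) ^ N ≠ 0 := pow_ne_zero _ (by exact_mod_cast S.q_pos.ne')
  have h := (hasSum_sum fun b (_ : b ∈ Finset.range (S.q ^ N)) => S.hasSum_affineLayer hΨ hΦ
    (translation (-S.u b) f) (translation (-S.u b) g)).mul_left (((S.q : ℂ) ^ N)⁻¹)
  simp_rw [hT _ f g] at h
  rw [Finset.sum_const, Finset.card_range, nsmul_eq_mul, Nat.cast_pow,
    inv_mul_cancel_left₀ hq0] at h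
  exact h

/-- By invariance the averaged layers still sum to `K_{Ψ,Φ}`. They agree with the quasi-affine
layers at scales `≥ -N`, so the difference of the forms is bounded, for every `N`, by two tails that
vanish as `N → ∞`. -/
lemma affineForm_eq_of_isTranslationInvariant {Ψ Φ : Fin L → L2 K} (hΨ : S.IsAffineBessel Ψ)
    (hΦ : S.IsAffineBessel Φ) (hT : IsTranslationInvariant (S.affineForm Ψ Φ)) :
    S.affineForm Ψ Φ = S.quasiAffineForm Ψ Φ := by
  funext f g
  rw [← sub_eq_zero, ← enorm_eq_zero, ← nonpos_iff_eq_zero]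
  set c : ℕ → ℝ≥0∞ := fun i => ‖S.quasiAffineLayer Ψ Φ f g (-(i : ℤ))‖ₑ with hc
  have hcs : ∑' i, c i ≠ ∞ := by
    have h1 : Summable fun i : ℕ => S.quasiAffineLayer Ψ Φ f g (-(i : ℤ)) :=
      (S.hasSum_quasiAffineLayer hΨ hΦ f g).summable.comp_injective
        (i := fun i : ℕ => -(i : ℤ)) fun a b hab => by simpa using hab
    exact ENNReal.tsum_coe_ne_top_iff_summable.2 (NNReal.summable_coe.1 h1.norm)
  have hlim : Filter.Tendsto (fun N => (S.tailMean Ψ N f + S.tailMean Φ N g) +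
      ∑' i, c (i + (N + 1))) Filter.atTop (nhds 0) := by
    have h := ((S.tendsto_tailMean hΨ f).add (S.tendsto_tailMean hΦ g)).add
      ((ENNReal.tendsto_sum_nat_add c hcs).comp (Filter.tendsto_add_atTop_nat 1))
    simpa using h
  refine ge_of_tendsto' hlim fun N => ?_
  have hD := (S.hasSum_layerMean hΨ hΦ hT f g N).sub (S.hasSum_quasiAffineLayer hΨ hΦ f g)
  have hinj : Function.Injective fun i : ℕ => -((N + 1 + i : ℕ) : ℤ) :=
    fun i j h => by simpa using h
  have hzero : ∀ j ∉ Set.range (fun i : ℕ => -((N + 1 + i : ℕ) : ℤ)),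
      S.layerMean Ψ Φ f g N j - S.quasiAffineLayer Ψ Φ f g j = 0 := by
    intro j hj
    have hN : -(N : ℤ) ≤ j := by
      by_contra hlt
      exact hj ⟨(-j - N - 1).toNat, by dsimp only; omega⟩
    rw [hΨ.quasiAffineLayer_eq S hΦ f g hN, layerMean, sub_self]
  -- Only the scales `-(N + 1 + i)` with `i ≥ 0` remain in the difference.
  rw [← hinj.hasSum_iff hzero] at hD
  rw [← hD.tsum_eq]
  refine enorm_tsum_le_tsum_enorm.trans ?_
  calc _ ≤ ∑' i : ℕ, (‖S.layerMean Ψ Φ f g N (-((N + 1 + i : ℕ) : ℤ))‖ₑ + c (i + (N + 1))) :=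
        ENNReal.tsum_le_tsum fun i => by
          refine enorm_sub_le.trans_eq ?_
          rw [hc, add_comm i]
    _ ≤ _ := by
        rw [ENNReal.tsum_add]
        gcongr
        exact S.tsum_enorm_layerMean_le Ψ Φ f g N

/-! ### Equality of the forms implies translation invariance. -/

lemma quasiAffineForm_translation_u {Ψ Φ : Fin L → L2 K} (hΨ : S.IsAffineBessel Ψ)
    (hΦ : S.IsAffineBessel Φ) (t : ℕ) (f g : L2 K) :
    S.quasiAffineForm Ψ Φ (translation (S.u t) f) (translation (S.u t) g) =
      S.quasiAffineForm Ψ Φ f g := by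
  rw [← (S.hasSum_quasiAffineLayer hΨ hΦ _ _).tsum_eq,
    ← (S.hasSum_quasiAffineLayer hΨ hΦ f g).tsum_eq]
  refine tsum_congr fun j => ?_
  -- The averaging level depends on the scale: it must reach down to `j` and its `q ^ N` points must
  -- include `u t`.
  have hN : -((max t j.natAbs : ℕ) : ℤ) ≤ j := by
    have := le_max_right t j.natAbs
    omega
  have ht : t < S.q ^ max t j.natAbs :=
    (le_max_left _ _).trans_lt (Nat.lt_pow_self S.one_lt_q)
  rw [hΨ.quasiAffineLayer_eq S hΦ _ _ hN, hΨ.quasiAffineLayer_eq S hΦ f g hN,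
    S.sum_translation_neg_add (fun f g => S.affineLayer Ψ Φ f g j) f g ht]

lemma affineTerm_dilation (Ψ Φ : Fin L → L2 K) (m : ℤ) (f g : L2 K) (l : Fin L) (j : ℤ) (k : ℕ) :
    S.affineTerm Ψ Φ (S.dilation m f) (S.dilation m g) l j k =
      S.affineTerm Ψ Φ f g l (j - m) k := by
  have h : ∀ h : L2 K, S.affine h j k = S.dilation m (S.affine h (j - m) k) := fun h => by
    rw [affine, affine, dilation_dilation, add_sub_cancel]
  rw [affineTerm, affineTerm, h, h, ip_dilation, ip_dilation]

lemma affineForm_dilation (Ψ Φ : Fin L → L2 K) (m : ℤ) (f g : L2 K) :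
    S.affineForm Ψ Φ (S.dilation m f) (S.dilation m g) = S.affineForm Ψ Φ f g := by
  unfold affineForm
  simp_rw [affineTerm_dilation]
  exact Finset.sum_congr rfl fun l _ =>
    (Equiv.subRight m).tsum_eq fun j => ∑' k, S.affineTerm Ψ Φ f g l j k

/-- Conjugation by `δ_m` turns translation by `u t` into translation by `ϖ^m u t`, and the affine
form does not see dilations. -/
lemma affineForm_translation_pow_mul_u {Ψ Φ : Fin L → L2 K}
    (h : ∀ (t : ℕ) (f g : L2 K), S.affineForm Ψ Φ (translation (S.u t) f) (translation (S.u t) g) =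
      S.affineForm Ψ Φ f g) (m : ℤ) (t : ℕ) (f g : L2 K) :
    S.affineForm Ψ Φ (translation ((S.ϖ : K) ^ m * S.u t) f)
      (translation ((S.ϖ : K) ^ m * S.u t) g) = S.affineForm Ψ Φ f g := by
  have e : ∀ f : L2 K, S.dilation m (S.dilation (-m) f) = f := fun f => by
    rw [dilation_dilation, add_neg_cancel, dilation_zero]
  conv_lhs => rw [← e f, ← e g]
  rw [← dilation_translation, ← dilation_translation, affineForm_dilation, h,
    ← affineForm_dilation S Ψ Φ m, e, e]

/-- The analysis operator of an affine Bessel family. -/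
noncomputable def analysis {Ψ : Fin L → L2 K} (hΨ : S.IsAffineBessel Ψ) :
    L2 K →L[ℂ] lp (fun _ : Fin L × ℤ × ℕ => ℂ) 2 :=
  LinearMap.mkContinuous
    { toFun := fun f => ⟨fun i => ip f (S.affine (Ψ i.1) i.2.1 i.2.2),
        memℓp_gen (by simpa using (hΨ.choose_spec.2 f).1)⟩
      map_add' := fun f g => by ext i; exact ip_add_left _ _ _
      map_smul' := fun c f => by ext i; exact ip_smul_left _ _ _ }
    (Real.sqrt hΨ.choose) fun f => by
      refine lp.norm_le_of_tsum_le (by simp) (by positivity) ?_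
      have h := (hΨ.choose_spec.2 f).2
      have hB := hΨ.choose_spec.1
      simp only [ENNReal.toReal_ofNat, Real.rpow_ofNat, mul_pow, Real.sq_sqrt hB.le]
      exact h

/-- Yields joint continuity of the form, since the analysis operators are bounded. -/
lemma affineForm_eq_inner {Ψ Φ : Fin L → L2 K} (hΨ : S.IsAffineBessel Ψ) (hΦ : S.IsAffineBessel Φ)
    (f g : L2 K) : S.affineForm Ψ Φ f g = inner ℂ (S.analysis hΦ g) (S.analysis hΨ f) := by
  have hs := S.summable_affineTerm hΨ hΦ f g
  rw [lp.inner_eq_tsum]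
  have h : ∀ i : Fin L × ℤ × ℕ, inner ℂ (S.analysis hΦ g i) (S.analysis hΨ f i) =
      S.affineTerm Ψ Φ f g i.1 i.2.1 i.2.2 := fun i => by
    rw [RCLike.inner_apply, affineTerm, ← ip_conj g]
    rfl
  simp_rw [h]
  rw [hs.tsum_prod, tsum_fintype (β := Fin L)]
  exact Finset.sum_congr rfl fun l _ => ((hs.prod_factor l).tsum_prod).symm

/-- Every `y` is a limit of points `ϖ^n u (b n)`, at which invariance is known; strong continuity of
translations passes it to `y`. -/
lemma isTranslationInvariant_of_affineForm_eq {Ψ Φ : Fin L → L2 K} (hΨ : S.IsAffineBessel Ψ)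
    (hΦ : S.IsAffineBessel Φ) (h : S.affineForm Ψ Φ = S.quasiAffineForm Ψ Φ) :
    IsTranslationInvariant (S.affineForm Ψ Φ) := by
  intro y f g
  obtain ⟨b, hb⟩ := S.exists_tendsto_u y
  have hu : ∀ (t : ℕ) (f g : L2 K), S.affineForm Ψ Φ (translation (S.u t) f)
      (translation (S.u t) g) = S.affineForm Ψ Φ f g := fun t f g => by
    rw [h]
    exact S.quasiAffineForm_translation_u hΨ hΦ t f g
  have hcont : Continuous fun y => S.affineForm Ψ Φ (translation y f) (translation y g) := by
    simp_rw [affineForm_eq_inner S hΨ hΦ]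
    exact ((S.analysis hΦ).continuous.comp (continuous_translation g)).inner
      ((S.analysis hΨ).continuous.comp (continuous_translation f))
  refine tendsto_nhds_unique ((hcont.tendsto y).comp hb) ?_
  refine tendsto_const_nhds.congr fun n => ?_
  have := S.affineForm_translation_pow_mul_u hu (n : ℤ) (b n) f g
  rw [zpow_natCast] at this
  exact this.symm

end LatticeData

end LocalFieldFrames

theorem theorem3p4 {K : Type*} [Field K] [ValuativeRel K] [TopologicalSpace K]
    [IsNonarchimedeanLocalField K] [MeasurableSpace K] [BorelSpace K]
    (p : ℕ) [Fact p.Prime] [CharP K p] (S : LocalFieldFrames.LatticeData K p)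
    (L : ℕ) (Ψ Φ : Fin L → LocalFieldFrames.L2 K)
    (hΨ : S.IsAffineBessel Ψ) (hΦ : S.IsAffineBessel Φ) :
    (∀ f g : LocalFieldFrames.L2 K,
      Summable (fun i : Fin L × ℤ × ℕ => S.affineTerm Ψ Φ f g i.1 i.2.1 i.2.2)) ∧
    (∀ f g : LocalFieldFrames.L2 K,
      Summable (fun i : Fin L × ℤ × ℕ => S.quasiAffineTerm Ψ Φ f g i.1 i.2.1 i.2.2)) ∧
    (LocalFieldFrames.IsTranslationInvariant (S.affineForm Ψ Φ) ↔
      S.affineForm Ψ Φ = S.quasiAffineForm Ψ Φ) :=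
  ⟨S.summable_affineTerm hΨ hΦ, S.summable_quasiAffineTerm hΨ hΦ,
    S.affineForm_eq_of_isTranslationInvariant hΨ hΦ,
    S.isTranslationInvariant_of_affineForm_eq hΨ hΦ⟩
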